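/- Let $c(x,y)=(x_1-y_1)(x_2-y_2)$ for $x,y\in\mathbb{R}^2$, and let $\mathcal{P}_2(\mathbb{R}^d)$ be the set of Borel probability measures on $\mathbb{R}^d$ with finite second moment. For $\nu\in\mathcal{P}_2(\mathbb{R}^2)$ let $\Gamma(\nu)$ be the set of all $\gamma=\gamma(dx,dy)\in\mathcal{P}_2(\mathbb{R}^2\times\mathbb{R}^2)$ with $y$-marginal $\nu$ and with the martingale property $\gamma(y\,|\,x)=x$ ($\gamma$-a.s.), where $\gamma(y\,|\,x)$ is the conditional expectation of $y$ given $x$ under $\gamma$. A plan $\gamma\in\Gamma(\nu)$ is optimal if it minimizes $\int c(x,y)\,d\gamma$ over $\Gamma(\nu)$. A set $G\subset\mathbb{R}^2$ is monotone if $c(r,s)\ge 0$ for all $r,s\in G$, and maximal monotone if, in addition, it is not a proper subset of a monotone set. For a maximal monotone set $G$ let $\phi_G(y)=\inf_{z\in G}c(z,y)\in[-\infty,\infty)$, $y\in\mathbb{R}^2$. The support $\operatorname{supp}$ of a Borel probability measure is the smallest closed set of full measure. Theorem. Let $\nu\in\mathcal{P}_2(\mathbb{R}^2)$. An optimal plan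 exists. For $\gamma\in\Gamma(\nu)$ the following conditions are equivalent: (a) $\gamma$ is an optimal plan. (b) If $(x^0,y^0)$ and $(x^1,y^1)$ belong to $\operatorname{supp}\gamma$, then $$(1-t)\,c(x^0,y^0)+t\,c(x^1,y^1)\le t(1-t)\,c(y^0,y^1),\qquad t\in[0,1].$$ (c) There is a maximal monotone set $G$ such that $$c(x,y)\le\phi_G(y),\qquad (x,y)\in\operatorname{supp}\gamma. \tag{1}$$ Moreover, if $\gamma\in\Gamma(\nu)$ has $x$-marginal $\mu$ and $G$ is a maximal monotone set satisfying (1), then $G$ contains $\operatorname{supp}\mu$ and $$c(x,y)=\phi_G(y)=\min_{z\in G}c(z,y),\qquad (x,y)\in\operatorname{supp}\gamma,$$ where the minimum is attained. -/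

import Mathlib

open MeasureTheory

/-- Probability measures with finite second moment, `𝒫₂(E)`. On a finite-dimensional space the
condition does not depend on the norm, so `ℝ × ℝ` is used as the plane. -/
def HasP2 {E : Type*} [NormedAddCommGroup E] [MeasurableSpace E] (μ : Measure E) : Prop :=
  IsProbabilityMeasure μ ∧ MemLp id 2 μ

/-- The covariance-type cost `c(x, y) = (x₁ - y₁)(x₂ - y₂)` on the plane. -/
def covCost (x y : ℝ × ℝ) : ℝ := (x.1 - y.1) * (x.2 - y.2)

/-- `Γ(ν)`: the plans `γ(dx, dy)` with finite second moment, `y`-marginal `ν`, and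
`E[y | x] = x` under `γ`. -/
noncomputable def martingalePlans (ν : Measure (ℝ × ℝ)) :
    Set (Measure ((ℝ × ℝ) × (ℝ × ℝ))) :=
  {γ | HasP2 γ ∧ γ.map Prod.snd = ν ∧
    γ[(Prod.snd : (ℝ × ℝ) × (ℝ × ℝ) → ℝ × ℝ) |
      MeasurableSpace.comap (Prod.fst : (ℝ × ℝ) × (ℝ × ℝ) → ℝ × ℝ) inferInstance]
      =ᵐ[γ] Prod.fst}

/-- `γ` minimizes `∫ c dγ` over `Γ(ν)`. The cost is integrable under every element of `Γ(ν)`,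
because it has quadratic growth. -/
def IsOptimalPlan (ν : Measure (ℝ × ℝ)) (γ : Measure ((ℝ × ℝ) × (ℝ × ℝ))) : Prop :=
  γ ∈ martingalePlans ν ∧
    ∀ ζ ∈ martingalePlans ν, ∫ p, covCost p.1 p.2 ∂γ ≤ ∫ p, covCost p.1 p.2 ∂ζ

/-- A monotone subset of the plane. -/
def IsMonotoneSet (G : Set (ℝ × ℝ)) : Prop := ∀ r ∈ G, ∀ s ∈ G, 0 ≤ covCost r s

/-- A monotone subset of the plane that is not a proper subset of a monotone set. -/
def IsMaximalMonotoneSet (G : Set (ℝ × ℝ)) : Prop := Maximal IsMonotoneSet G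

/-- `φ_G(y) = inf_{z ∈ G} c(z, y)`, with values in the extended reals. -/
noncomputable def phiG (G : Set (ℝ × ℝ)) (y : ℝ × ℝ) : EReal := ⨅ z ∈ G, (covCost z y : EReal)

/-! With u = z₁ + z₂ and v = z₁ - z₂ the cost is a quarter of (Δu)² - (Δv)², so monotone sets are
the graphs of 1-Lipschitz functions v = f(u), and the maximal ones are those with f defined on all
of ℝ (`IsMaximalMonotoneSet.exists_eq_rotatedGraph`). The projection π along v onto such a graph
satisfies c(π(x), x) ≤ 0, with equality only on the graph.

(c) implies (a) by duality. Since π(x) - x depends on x alone, the martingale property gives ∫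
c(π(x), y) = ∫ c(x, y) + ∫ c(π(x), x) ≤ ∫ c(x, y) for every plan. Hence ∫ φ_G dν bounds all costs
from below, and a plan satisfying (1) reaches this bound (`isOptimalPlan_of_le`). The same identity
forces c(π(x), x) = 0 almost surely under (1), which places supp μ in G and x among the minimizers.

(b) implies (c). For a pair (x, y) the set of z with c(z, y) ≥ c(x, y) is the region between two
1-Lipschitz functions of u. Condition (b) puts every lower function below every upper one, and the
infimum of the upper ones has the required graph.

(a) implies (b) by perturbation. A small portion εh of γ has its x-coordinates moved to its own
barycentre, and x is then replaced by E[y | x] to restore the martingale property. This correction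
costs only O(ε²) (`drift_sq_le`), so the first-order term says that the mean cost under h is at most
the covariance of y₁ and y₂ under h. Concentrating h at two support points gives (b).

Existence is the direct method. Jensen's inequality bounds the quadratic tails of all martingale
plans by those of ν, which gives tightness, closedness and continuity of the cost. -/

/-! ### Rotated coordinates and maximal monotone sets. -/

/-- The graph of `f` in the rotated coordinates `u = z₁ + z₂`, `v = z₁ - z₂`. -/
def rotatedGraph (f : ℝ → ℝ) : Set (ℝ × ℝ) := {z | z.1 - z.2 = f (z.1 + z.2)}

/-- The point of `rotatedGraph f` with the same coordinate `z₁ + z₂` as the given point. -/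
noncomputable def rotatedProj (f : ℝ → ℝ) (x : ℝ × ℝ) : ℝ × ℝ :=
  ((x.1 + x.2 + f (x.1 + x.2)) / 2, (x.1 + x.2 - f (x.1 + x.2)) / 2)

lemma covCost_eq_rotated (x y : ℝ × ℝ) :
    covCost x y = (((x.1 + x.2) - (y.1 + y.2)) ^ 2 - ((x.1 - x.2) - (y.1 - y.2)) ^ 2) / 4 := by
  unfold covCost; ring

lemma rotatedProj_mem (f : ℝ → ℝ) (x : ℝ × ℝ) : rotatedProj f x ∈ rotatedGraph f := by
  simp only [rotatedGraph, rotatedProj, Set.mem_ofPred_eq]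
  ring_nf

lemma covCost_rotatedProj (f : ℝ → ℝ) (x : ℝ × ℝ) :
    covCost (rotatedProj f x) x = -((x.1 - x.2 - f (x.1 + x.2)) / 2) ^ 2 := by
  simp only [covCost, rotatedProj]; ring

lemma covCost_rotatedProj_nonpos (f : ℝ → ℝ) (x : ℝ × ℝ) : covCost (rotatedProj f x) x ≤ 0 := by
  rw [covCost_rotatedProj]; nlinarith [sq_nonneg ((x.1 - x.2 - f (x.1 + x.2)) / 2)]

lemma mem_rotatedGraph_of_covCost_eq_zero {f : ℝ → ℝ} {x : ℝ × ℝ}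
    (h : covCost (rotatedProj f x) x = 0) : x ∈ rotatedGraph f := by
  rw [covCost_rotatedProj, neg_eq_zero, sq_eq_zero_iff] at h
  change x.1 - x.2 = f (x.1 + x.2)
  linarith

lemma isClosed_rotatedGraph {f : ℝ → ℝ} (hf : Continuous f) : IsClosed (rotatedGraph f) :=
  isClosed_eq (by fun_prop) (by fun_prop)

lemma continuous_rotatedProj {f : ℝ → ℝ} (hf : Continuous f) : Continuous (rotatedProj f) := by
  unfold rotatedProj; fun_prop

lemma isMonotoneSet_rotatedGraph {f : ℝ → ℝ} (hf : LipschitzWith 1 f) :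
    IsMonotoneSet (rotatedGraph f) := by
  intro r hr s hs
  have h := hf.dist_le_mul (r.1 + r.2) (s.1 + s.2)
  simp only [Real.dist_eq, NNReal.coe_one, one_mul] at h
  rw [covCost_eq_rotated, show r.1 - r.2 = _ from hr, show s.1 - s.2 = _ from hs]
  have := sq_le_sq.2 h
  linarith

/-- A point x of a larger monotone set has nonnegative cost to its projection, while that cost is
never positive. It therefore vanishes, and x lies on the graph. -/
lemma isMaximalMonotoneSet_rotatedGraph {f : ℝ → ℝ} (hf : LipschitzWith 1 f) :
    IsMaximalMonotoneSet (rotatedGraph f) := by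
  refine ⟨isMonotoneSet_rotatedGraph hf, fun G' hG' hle x hx => ?_⟩
  refine mem_rotatedGraph_of_covCost_eq_zero ?_
  exact le_antisymm (covCost_rotatedProj_nonpos f x) (hG' _ (hle (rotatedProj_mem f x)) _ hx)

/-- A maximal monotone set is the graph of a `1`-Lipschitz function in rotated coordinates. -/
lemma IsMaximalMonotoneSet.exists_eq_rotatedGraph {G : Set (ℝ × ℝ)} (hG : IsMaximalMonotoneSet G) :
    ∃ f : ℝ → ℝ, LipschitzWith 1 f ∧ G = rotatedGraph f := by
  classical
  let S : Set ℝ := (fun z : ℝ × ℝ => z.1 + z.2) '' G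
  have key : ∀ r ∈ G, ∀ s ∈ G, |(r.1 - r.2) - (s.1 - s.2)| ≤ |(r.1 + r.2) - (s.1 + s.2)| := by
    intro r hr s hs
    have := hG.1 r hr s hs
    rw [covCost_eq_rotated] at this
    exact sq_le_sq.1 (by linarith)
  -- A section of the coordinate u over the image of G. The value 0 off `S` plays no role, since
  -- only the restriction to `S` is extended to a Lipschitz function.
  let z : ℝ → ℝ × ℝ := fun u => if h : u ∈ S then h.choose else 0
  have hz : ∀ u ∈ S, z u ∈ G ∧ (z u).1 + (z u).2 = u := by
    intro u hu
    simp only [z, dif_pos hu]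
    exact hu.choose_spec
  have hL : LipschitzOnWith 1 (fun u => (z u).1 - (z u).2) S := by
    refine LipschitzOnWith.of_dist_le_mul fun u hu w hw => ?_
    have := key _ (hz u hu).1 _ (hz w hw).1
    rw [(hz u hu).2, (hz w hw).2] at this
    simpa only [Real.dist_eq, NNReal.coe_one, one_mul] using this
  obtain ⟨f, hf, hfeq⟩ := hL.extend_real
  refine ⟨f, hf, hG.eq_of_subset (isMonotoneSet_rotatedGraph hf) fun x hx => ?_⟩
  have hu : x.1 + x.2 ∈ S := ⟨x, hx, rfl⟩
  have h1 := key _ hx _ (hz _ hu).1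
  rw [(hz _ hu).2, sub_self, abs_zero, abs_nonpos_iff] at h1
  have h2 := hfeq hu
  simp only at h2
  change x.1 - x.2 = f (x.1 + x.2)
  linarith

/-! ### From the pairwise inequality to a maximal monotone set. -/

/-- The pairwise inequality satisfied by the support of an optimal plan, for a set of pairs. -/
def PairwiseOptimal (S : Set ((ℝ × ℝ) × (ℝ × ℝ))) : Prop :=
  ∀ x₀ y₀ x₁ y₁ : ℝ × ℝ, (x₀, y₀) ∈ S → (x₁, y₁) ∈ S → ∀ t ∈ Set.Icc (0 : ℝ) 1,
    (1 - t) * covCost x₀ y₀ + t * covCost x₁ y₁ ≤ t * (1 - t) * covCost y₀ y₁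

lemma sqrt_sq_add_le (s s' : ℝ) {a : ℝ} (ha : 0 ≤ a) :
    √(s ^ 2 + a) ≤ √(s' ^ 2 + a) + |s - s'| := by
  have h1 : |s'| ≤ √(s' ^ 2 + a) := Real.abs_le_sqrt (by linarith)
  have h2 := Real.sq_sqrt (show 0 ≤ s' ^ 2 + a by positivity)
  refine Real.sqrt_le_iff.2 ⟨by positivity, ?_⟩
  have h3 : s ^ 2 ≤ (|s'| + |s - s'|) ^ 2 := by
    rw [← sq_abs s]
    have : |s| ≤ |s'| + |s - s'| := by
      have := abs_add_le s' (s - s'); rwa [add_sub_cancel] at this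
    gcongr
  nlinarith [abs_nonneg (s - s'), sq_abs s', mul_le_mul_of_nonneg_right h1 (abs_nonneg (s - s'))]

/-- The optimal choice is t = P / (P + Q), for which the right side equals PQ and t(1 - t) = PQ / (P
+ Q)². -/
lemma sq_le_add_sq_of_forall_convexCombo {d a b : ℝ} {P Q : ℝ} (hP : 0 ≤ P) (hQ : 0 ≤ Q)
    (ha : a = P ^ 2) (hb : b = Q ^ 2)
    (h : ∀ t ∈ Set.Icc (0 : ℝ) 1, t * (1 - t) * d ≤ (1 - t) * a + t * b) :
    d ≤ (P + Q) ^ 2 := by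
  subst ha hb
  -- Adding ε to both P and Q permits division by their product when one of them vanishes.
  have key : ∀ ε > 0, d ≤ (P + Q + 2 * ε) ^ 2 := by
    intro ε hε
    have hs : 0 < P + Q + 2 * ε := by linarith
    have hp : 0 < P + ε := by linarith
    have hq : 0 < Q + ε := by linarith
    have h1 : 1 - (P + ε) / (P + Q + 2 * ε) = (Q + ε) / (P + Q + 2 * ε) := by
      field_simp; ring
    have := h ((P + ε) / (P + Q + 2 * ε)) ⟨by positivity, by
      rw [div_le_one hs]; linarith⟩
    rw [h1] at this
    have h2 : (Q + ε) / (P + Q + 2 * ε) * P ^ 2 + (P + ε) / (P + Q + 2 * ε) * Q ^ 2 ≤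
        (P + ε) * (Q + ε) := by
      rw [div_mul_eq_mul_div, div_mul_eq_mul_div, ← add_div, div_le_iff₀ hs]
      have : P ^ 2 ≤ (P + ε) ^ 2 := by gcongr; linarith
      have : Q ^ 2 ≤ (Q + ε) ^ 2 := by gcongr; linarith
      nlinarith
    have h3 := this.trans h2
    have h4 : (P + ε) / (P + Q + 2 * ε) * ((Q + ε) / (P + Q + 2 * ε)) * d =
        ((P + ε) * (Q + ε)) * (d / (P + Q + 2 * ε) ^ 2) := by
      field_simp
    rw [h4] at h3
    have h5 : d / (P + Q + 2 * ε) ^ 2 ≤ 1 := by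
      by_contra! hc
      have := mul_lt_mul_of_pos_left hc (mul_pos hp hq)
      linarith
    rwa [div_le_one (by positivity)] at h5
  have lim : Filter.Tendsto (fun ε : ℝ => (P + Q + 2 * ε) ^ 2) (nhdsWithin 0 (Set.Ioi 0))
      (nhds ((P + Q + 2 * 0) ^ 2)) :=
    (Continuous.tendsto (by fun_prop) 0).mono_left nhdsWithin_le_nhds
  rw [mul_zero, add_zero] at lim
  exact ge_of_tendsto lim (by filter_upwards [self_mem_nhdsWithin] with ε hε using key ε hε)

lemma PairwiseOptimal.covCost_nonpos {S : Set ((ℝ × ℝ) × (ℝ × ℝ))} (hS : PairwiseOptimal S)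
    {x y : ℝ × ℝ} (h : (x, y) ∈ S) : covCost x y ≤ 0 := by
  have := hS x y x y h h 0 (by simp)
  simpa using this

/-- A pairwise optimal set admits a maximal monotone set of minimizers. -/
lemma PairwiseOptimal.exists_isMaximalMonotoneSet {S : Set ((ℝ × ℝ) × (ℝ × ℝ))}
    (hS : PairwiseOptimal S) (hne : S.Nonempty) :
    ∃ G, IsMaximalMonotoneSet G ∧
      ∀ x y, (x, y) ∈ S → ∀ z ∈ G, covCost x y ≤ covCost z y := by
  let U : (ℝ × ℝ) × (ℝ × ℝ) → ℝ := fun p => p.2.1 + p.2.2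
  let V : (ℝ × ℝ) × (ℝ × ℝ) → ℝ := fun p => p.2.1 - p.2.2
  let A : (ℝ × ℝ) × (ℝ × ℝ) → ℝ := fun p => -4 * covCost p.1 p.2
  have hA : ∀ p : S, 0 ≤ A p := fun p => by
    have := hS.covCost_nonpos p.2
    simp only [A]; linarith
  let r : S → ℝ → ℝ := fun p u => √((u - U p) ^ 2 + A p)
  -- For z with coordinates (u, v), c(z, y) ≥ c(x, y) means |v - V| ≤ r(u). The lower barrier of `q`
  -- must lie below the upper barrier of `p`.
  have cross : ∀ (p q : S) (u : ℝ), V q - r q u ≤ V p + r p u := by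
    intro p q u
    have h1 : (V q - V p) ^ 2 ≤ (r p u + r q u) ^ 2 := by
      refine sq_le_add_sq_of_forall_convexCombo (Real.sqrt_nonneg _) (Real.sqrt_nonneg _)
        (Real.sq_sqrt (by have := hA p; positivity)).symm
        (Real.sq_sqrt (by have := hA q; positivity)).symm fun t ht => ?_
      have h := hS _ _ _ _ p.2 q.2 t ht
      rw [covCost_eq_rotated (p : (ℝ × ℝ) × (ℝ × ℝ)).2] at h
      -- Second moment about u = squared distance from u to the mean + variance. Dropping the
      -- squared distance leaves a bound free of u, to which the hypothesis applies.
      have e : (1 - t) * (u - U p) ^ 2 + t * (u - U q) ^ 2 =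
        (u - ((1 - t) * U p + t * U q)) ^ 2 + t * (1 - t) * (U p - U q) ^ 2 := by ring
      have := sq_nonneg (u - ((1 - t) * U p + t * U q))
      simp only [U, V, A] at *
      nlinarith
    have h2 := abs_le_of_sq_le_sq h1 (add_nonneg (Real.sqrt_nonneg _) (Real.sqrt_nonneg _))
    linarith [le_abs_self (V q - V p)]
  have : Nonempty S := hne.to_subtype
  -- The lowest upper barrier: it inherits the Lipschitz constant 1 and, by `cross`, stays above all
  -- lower barriers.
  let f : ℝ → ℝ := fun u => ⨅ p : S, (V p + r p u)
  have hbdd : ∀ u, BddBelow (Set.range fun p : S => V p + r p u) := by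
    intro u
    obtain ⟨q⟩ := ‹Nonempty S›
    exact ⟨V q - r q u, by rintro _ ⟨p, rfl⟩; exact cross p q u⟩
  have hf : LipschitzWith 1 f := by
    refine LipschitzWith.of_le_add fun u w => ?_
    rw [← sub_le_iff_le_add]
    refine le_ciInf fun p => ?_
    have h1 : f u ≤ V p + r p u := ciInf_le (hbdd u) p
    have h2 := sqrt_sq_add_le (u - U p) (w - U p) (hA p)
    rw [sub_sub_sub_cancel_right] at h2
    simp only [r, Real.dist_eq] at *
    linarith
  refine ⟨rotatedGraph f, isMaximalMonotoneSet_rotatedGraph hf, fun x y hxy z hz => ?_⟩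
  let p : S := ⟨(x, y), hxy⟩
  have hz' : z.1 - z.2 = f (z.1 + z.2) := hz
  have h1 : f (z.1 + z.2) ≤ V p + r p (z.1 + z.2) := ciInf_le (hbdd _) p
  have h2 : V p - r p (z.1 + z.2) ≤ f (z.1 + z.2) := le_ciInf fun q => cross q p _
  have h3 : |z.1 - z.2 - V p| ≤ r p (z.1 + z.2) := abs_le.2 ⟨by linarith, by linarith⟩
  have h4 := Real.sq_sqrt (show 0 ≤ (z.1 + z.2 - U p) ^ 2 + A p by have := hA p; positivity)
  have h5 : (z.1 - z.2 - V p) ^ 2 ≤ r p (z.1 + z.2) ^ 2 := by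
    rw [← sq_abs (z.1 - z.2 - V p)]; gcongr
  rw [covCost_eq_rotated z y]
  simp only [r, h4] at h5
  simp only [U, V, A, p] at h5
  linarith

lemma coe_covCost_le_phiG_iff {G : Set (ℝ × ℝ)} {x y : ℝ × ℝ} :
    (covCost x y : EReal) ≤ phiG G y ↔ ∀ z ∈ G, covCost x y ≤ covCost z y := by
  simp [phiG]

/-! ### Square integrability and the martingale property as orthogonality. -/

lemma HasP2.memLp_of_norm_le {E : Type*} [NormedAddCommGroup E] [MeasurableSpace E]
    {μ : Measure E} (h : HasP2 μ) {f : E → ℝ} (hf : AEStronglyMeasurable f μ)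
    (hle : ∀ p, ‖f p‖ ≤ ‖p‖) : MemLp f 2 μ :=
  h.2.mono hf (Filter.Eventually.of_forall hle)

section Coordinates

variable {γ : Measure ((ℝ × ℝ) × (ℝ × ℝ))}

lemma HasP2.memLp_fst_fst (h : HasP2 γ) : MemLp (fun p => p.1.1) 2 γ :=
  h.memLp_of_norm_le (by fun_prop) fun p => (norm_fst_le p.1).trans (norm_fst_le p)

lemma HasP2.memLp_fst_snd (h : HasP2 γ) : MemLp (fun p => p.1.2) 2 γ :=
  h.memLp_of_norm_le (by fun_prop) fun p => (norm_snd_le p.1).trans (norm_fst_le p)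

lemma HasP2.memLp_snd_fst (h : HasP2 γ) : MemLp (fun p => p.2.1) 2 γ :=
  h.memLp_of_norm_le (by fun_prop) fun p => (norm_fst_le p.2).trans (norm_snd_le p)

lemma HasP2.memLp_snd_snd (h : HasP2 γ) : MemLp (fun p => p.2.2) 2 γ :=
  h.memLp_of_norm_le (by fun_prop) fun p => (norm_snd_le p.2).trans (norm_snd_le p)

lemma memLp_prodMk {α : Type*} [MeasurableSpace α] {μ : Measure α} {f g : α → ℝ}
    (hf : MemLp f 2 μ) (hg : MemLp g 2 μ) : MemLp (fun a => (f a, g a)) 2 μ := by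
  refine (hf.norm.add hg.norm).mono (hf.1.prodMk hg.1) (Filter.Eventually.of_forall fun a => ?_)
  rw [Prod.norm_def]
  simp only [Pi.add_apply]
  have h : (0 : ℝ) ≤ ‖f a‖ + ‖g a‖ := by positivity
  rw [Real.norm_of_nonneg h]
  exact max_le (le_add_of_nonneg_right (norm_nonneg _)) (le_add_of_nonneg_left (norm_nonneg _))

end Coordinates

lemma MemLp.fst_real {α : Type*} [MeasurableSpace α] {μ : Measure α} {f : α → ℝ × ℝ}
    (hf : MemLp f 2 μ) : MemLp (fun a => (f a).1) 2 μ :=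
  hf.mono hf.1.fst (Filter.Eventually.of_forall fun a => norm_fst_le (f a))

lemma MemLp.snd_real {α : Type*} [MeasurableSpace α] {μ : Measure α} {f : α → ℝ × ℝ}
    (hf : MemLp f 2 μ) : MemLp (fun a => (f a).2) 2 μ :=
  hf.mono hf.1.snd (Filter.Eventually.of_forall fun a => norm_snd_le (f a))

lemma integrable_covCost {α : Type*} [MeasurableSpace α] {μ : Measure α} {f g : α → ℝ × ℝ}
    (hf : MemLp f 2 μ) (hg : MemLp g 2 μ) : Integrable (fun a => covCost (f a) (g a)) μ :=
  (MemLp.fst_real (hf.sub hg)).integrable_mul (MemLp.snd_real (hf.sub hg))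

lemma HasP2.memLp_fst {γ : Measure ((ℝ × ℝ) × (ℝ × ℝ))} (h : HasP2 γ) : MemLp Prod.fst 2 γ :=
  memLp_prodMk h.memLp_fst_fst h.memLp_fst_snd

lemma HasP2.memLp_snd {γ : Measure ((ℝ × ℝ) × (ℝ × ℝ))} (h : HasP2 γ) : MemLp Prod.snd 2 γ :=
  memLp_prodMk h.memLp_snd_fst h.memLp_snd_snd

/-- Pythagorean identity for the indefinite form `covCost`. -/
lemma integral_covCost_eq_add {α : Type*} [MeasurableSpace α] {μ : Measure α}
    {x y z : α → ℝ × ℝ} (hx : MemLp x 2 μ) (hy : MemLp y 2 μ) (hz : MemLp z 2 μ)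
    (h₁ : ∫ a, ((z a).2 - (x a).2) * ((y a).1 - (x a).1) ∂μ = 0)
    (h₂ : ∫ a, ((z a).1 - (x a).1) * ((y a).2 - (x a).2) ∂μ = 0) :
    ∫ a, covCost (z a) (y a) ∂μ = ∫ a, covCost (x a) (y a) ∂μ + ∫ a, covCost (z a) (x a) ∂μ := by
  have i₁ : Integrable (fun a => ((z a).2 - (x a).2) * ((y a).1 - (x a).1)) μ :=
    (MemLp.snd_real (hz.sub hx)).integrable_mul (MemLp.fst_real (hy.sub hx))
  have i₂ : Integrable (fun a => ((z a).1 - (x a).1) * ((y a).2 - (x a).2)) μ :=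
    (MemLp.fst_real (hz.sub hx)).integrable_mul (MemLp.snd_real (hy.sub hx))
  rw [← integral_add (integrable_covCost hx hy) (integrable_covCost hz hx)]
  have e : ∀ a, covCost (z a) (y a) = (covCost (x a) (y a) + covCost (z a) (x a)) -
      (((z a).2 - (x a).2) * ((y a).1 - (x a).1) + ((z a).1 - (x a).1) * ((y a).2 - (x a).2)) := by
    intro a; simp only [covCost]; ring
  simp_rw [e]
  have i₃ : Integrable (fun a => covCost (x a) (y a) + covCost (z a) (x a)) μ :=
    (integrable_covCost hx hy).add (integrable_covCost hz hx)
  have i₄ : Integrable (fun a => ((z a).2 - (x a).2) * ((y a).1 - (x a).1) +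
    ((z a).1 - (x a).1) * ((y a).2 - (x a).2)) μ := i₁.add i₂
  rw [integral_sub i₃ i₄, integral_add i₁ i₂, h₁, h₂]
  simp

/-- Conditional expectations are orthogonal to square integrable functions of the conditioning. -/
lemma integral_mul_sub_condExp {α : Type*} {m m₀ : MeasurableSpace α} {μ : Measure α}
    [IsFiniteMeasure μ] (hm : m ≤ m₀) {f k x : α → ℝ} (hf : MemLp f 2 μ)
    (hx : μ[f | m] =ᵐ[μ] x) (hk : StronglyMeasurable[m] k) (hk2 : MemLp k 2 μ) :
    ∫ a, k a * (f a - x a) ∂μ = 0 := by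
  have hfi : Integrable f μ := hf.integrable one_le_two
  have hx2 : MemLp x 2 μ := (MemLp.condExp one_le_two hf).ae_eq hx
  have h1 : μ[k * f | m] =ᵐ[μ] k * μ[f | m] :=
    condExp_mul_of_stronglyMeasurable_left hk (hk2.integrable_mul hf) hfi
  have h2 : ∫ a, (k * f) a ∂μ = ∫ a, k a * x a ∂μ := by
    rw [← integral_condExp hm]
    refine integral_congr_ae ?_
    filter_upwards [h1, hx] with a ha hxa
    rw [ha, Pi.mul_apply, hxa]
  simp_rw [mul_sub]
  have i₁ : Integrable (fun a => k a * f a) μ := hk2.integrable_mul hf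
  have i₂ : Integrable (fun a => k a * x a) μ := hk2.integrable_mul hx2
  rw [integral_sub i₁ i₂]
  exact sub_eq_zero.2 h2

lemma fst_condExp {α : Type*} {m m₀ : MeasurableSpace α} {μ : Measure α}
    {f : α → ℝ × ℝ} (hf : Integrable f μ) :
    μ[fun a => (f a).1 | m] =ᵐ[μ] fun a => (μ[f | m] a).1 :=
  ((ContinuousLinearMap.fst ℝ ℝ ℝ).comp_condExp_comm hf).symm

lemma snd_condExp {α : Type*} {m m₀ : MeasurableSpace α} {μ : Measure α}
    {f : α → ℝ × ℝ} (hf : Integrable f μ) :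
    μ[fun a => (f a).2 | m] =ᵐ[μ] fun a => (μ[f | m] a).2 :=
  ((ContinuousLinearMap.snd ℝ ℝ ℝ).comp_condExp_comm hf).symm

lemma integral_mul_sub_eq_zero_of_mem {ν : Measure (ℝ × ℝ)}
    {γ : Measure ((ℝ × ℝ) × (ℝ × ℝ))} (hγ : γ ∈ martingalePlans ν) {ψ : ℝ × ℝ → ℝ}
    (hψ : Measurable ψ) (hψ2 : MemLp (fun p : (ℝ × ℝ) × (ℝ × ℝ) => ψ p.1) 2 γ) :
    ∫ p, ψ p.1 * (p.2.1 - p.1.1) ∂γ = 0 ∧ ∫ p, ψ p.1 * (p.2.2 - p.1.2) ∂γ = 0 := by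
  have := hγ.1.1
  have hi : Integrable (Prod.snd : (ℝ × ℝ) × (ℝ × ℝ) → ℝ × ℝ) γ :=
    hγ.1.memLp_snd.integrable one_le_two
  have hk : StronglyMeasurable[MeasurableSpace.comap (Prod.fst : (ℝ × ℝ) × (ℝ × ℝ) → ℝ × ℝ)
      inferInstance] (fun p : (ℝ × ℝ) × (ℝ × ℝ) => ψ p.1) :=
    (hψ.comp (comap_measurable _)).stronglyMeasurable
  constructor
  · refine integral_mul_sub_condExp measurable_fst.comap_le hγ.1.memLp_snd_fst ?_ hk hψ2
    exact (fst_condExp hi).trans (hγ.2.2.fun_comp Prod.fst)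
  · refine integral_mul_sub_condExp measurable_fst.comap_le hγ.1.memLp_snd_snd ?_ hk hψ2
    exact (snd_condExp hi).trans (hγ.2.2.fun_comp Prod.snd)

/-- The criterion by which conditional-expectation plans, weak limits and the diagonal plan are
recognized as martingale plans. -/
lemma mem_martingalePlans_of_setIntegral {ν : Measure (ℝ × ℝ)}
    {γ : Measure ((ℝ × ℝ) × (ℝ × ℝ))} (hγ : HasP2 γ) (hν : γ.map Prod.snd = ν)
    (h₁ : ∀ s : Set (ℝ × ℝ), MeasurableSet s →
      ∫ p in Prod.fst ⁻¹' s, p.1.1 ∂γ = ∫ p in Prod.fst ⁻¹' s, p.2.1 ∂γ)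
    (h₂ : ∀ s : Set (ℝ × ℝ), MeasurableSet s →
      ∫ p in Prod.fst ⁻¹' s, p.1.2 ∂γ = ∫ p in Prod.fst ⁻¹' s, p.2.2 ∂γ) :
    γ ∈ martingalePlans ν := by
  have := hγ.1
  have hi : Integrable (Prod.snd : (ℝ × ℝ) × (ℝ × ℝ) → ℝ × ℝ) γ :=
    hγ.memLp_snd.integrable one_le_two
  have hi' : Integrable (Prod.fst : (ℝ × ℝ) × (ℝ × ℝ) → ℝ × ℝ) γ :=
    hγ.memLp_fst.integrable one_le_two
  refine ⟨hγ, hν, (ae_eq_condExp_of_forall_setIntegral_eq measurable_fst.comap_le hi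
    (fun s _ _ => hi'.integrableOn) ?_ ?_).symm⟩
  · rintro _ ⟨s, hs, rfl⟩ -
    refine Prod.ext ?_ ?_
    · rw [fst_integral hi'.integrableOn, fst_integral hi.integrableOn]; exact h₁ s hs
    · rw [snd_integral hi'.integrableOn, snd_integral hi.integrableOn]; exact h₂ s hs
  · exact (comap_measurable _).stronglyMeasurable.aestronglyMeasurable

/-- The displacement π(x) - x is a function of x, hence orthogonal to y - x, and the mixed terms of
the quadratic form disappear. -/
lemma integral_covCost_comp_fst {ν : Measure (ℝ × ℝ)}
    {γ : Measure ((ℝ × ℝ) × (ℝ × ℝ))} (hγ : γ ∈ martingalePlans ν) {π : ℝ × ℝ → ℝ × ℝ}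
    (hπ : Measurable π) (hπ2 : MemLp (fun p : (ℝ × ℝ) × (ℝ × ℝ) => π p.1) 2 γ) :
    ∫ p, covCost (π p.1) p.2 ∂γ = ∫ p, covCost p.1 p.2 ∂γ + ∫ p, covCost (π p.1) p.1 ∂γ := by
  refine integral_covCost_eq_add hγ.1.memLp_fst hγ.1.memLp_snd hπ2 ?_ ?_
  · exact (integral_mul_sub_eq_zero_of_mem hγ (ψ := fun x => (π x).2 - x.2) (by fun_prop)
      ((MemLp.snd_real hπ2).sub hγ.1.memLp_fst_snd)).1
  · exact (integral_mul_sub_eq_zero_of_mem hγ (ψ := fun x => (π x).1 - x.1) (by fun_prop)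
      ((MemLp.fst_real hπ2).sub hγ.1.memLp_fst_fst)).2

lemma HasP2.memLp_rotatedProj {γ : Measure ((ℝ × ℝ) × (ℝ × ℝ))} (hγ : HasP2 γ) {f : ℝ → ℝ}
    (hf : LipschitzWith 1 f) :
    MemLp (fun p : (ℝ × ℝ) × (ℝ × ℝ) => rotatedProj f p.1) 2 γ := by
  have := hγ.1
  have hu : MemLp (fun p : (ℝ × ℝ) × (ℝ × ℝ) => p.1.1 + p.1.2) 2 γ :=
    hγ.memLp_fst_fst.add hγ.memLp_fst_snd
  have hv : MemLp (fun p : (ℝ × ℝ) × (ℝ × ℝ) => f (p.1.1 + p.1.2)) 2 γ := by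
    -- Composition with a Lipschitz function preserves square integrability when the function
    -- vanishes at 0; the constant f(0) is restored afterwards.
    have hg : LipschitzWith 1 (fun u => f u - f 0) := by
      simpa using hf.sub (LipschitzWith.const (f 0))
    have h2 := (hg.comp_memLp (by simp) hu).add (memLp_const (f 0))
    refine h2.ae_eq (Filter.Eventually.of_forall fun p => ?_)
    simp
  refine memLp_prodMk ?_ ?_
  · exact ((hu.add hv).mul_const (1 / 2)).ae_eq (Filter.Eventually.of_forall fun p => by
      simp; ring)
  · exact ((hu.sub hv).mul_const (1 / 2)).ae_eq (Filter.Eventually.of_forall fun p => by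
      simp; ring)

/-! ### Sufficiency of (c) by duality. -/

lemma ae_mem_support (γ : Measure ((ℝ × ℝ) × (ℝ × ℝ))) : ∀ᵐ p ∂γ, p ∈ γ.support :=
  Measure.support_mem_ae

/-- If every pair of the support minimizes over `G`, then `x ∈ G` almost surely. -/
lemma ae_fst_mem_rotatedGraph {ν : Measure (ℝ × ℝ)} {γ : Measure ((ℝ × ℝ) × (ℝ × ℝ))}
    (hγ : γ ∈ martingalePlans ν) {f : ℝ → ℝ} (hf : LipschitzWith 1 f)
    (h : ∀ᵐ p ∂γ, ∀ z ∈ rotatedGraph f, covCost p.1 p.2 ≤ covCost z p.2) :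
    ∀ᵐ p ∂γ, p.1 ∈ rotatedGraph f := by
  have hπ2 := hγ.1.memLp_rotatedProj hf
  have e := integral_covCost_comp_fst hγ (continuous_rotatedProj hf.continuous).measurable hπ2
  have h1 : ∫ p, covCost p.1 p.2 ∂γ ≤ ∫ p, covCost (rotatedProj f p.1) p.2 ∂γ := by
    refine integral_mono_ae (integrable_covCost hγ.1.memLp_fst hγ.1.memLp_snd)
      (integrable_covCost hπ2 hγ.1.memLp_snd) ?_
    filter_upwards [h] with p hp using hp _ (rotatedProj_mem f p.1)
  have hi := integrable_covCost hπ2 hγ.1.memLp_fst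
  -- Minimality and the Pythagorean identity give ∫ c(π(x), x) ≥ 0, while the integrand is nowhere
  -- positive.
  have h2 : ∫ p, -covCost (rotatedProj f p.1) p.1 ∂γ = 0 := by
    refine le_antisymm ?_ (integral_nonneg fun p => ?_)
    · rw [integral_neg]; linarith
    · simpa using covCost_rotatedProj_nonpos f p.1
  have hi' : Integrable (fun p => -covCost (rotatedProj f p.1) p.1) γ := hi.neg
  rw [integral_eq_zero_iff_of_nonneg (fun p => by
    simpa using covCost_rotatedProj_nonpos f p.1) hi'] at h2
  filter_upwards [h2] with p hp
  exact mem_rotatedGraph_of_covCost_eq_zero (by simpa using hp)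

lemma map_fst_support_subset {γ : Measure ((ℝ × ℝ) × (ℝ × ℝ))} {G : Set (ℝ × ℝ)}
    (hG : IsClosed G) (h : ∀ᵐ p ∂γ, p.1 ∈ G) : (γ.map Prod.fst).support ⊆ G := by
  refine Measure.support_subset_of_isClosed hG ?_
  exact (ae_map_iff measurable_fst.aemeasurable hG.measurableSet).2 h

lemma fst_mem_support_map {γ : Measure ((ℝ × ℝ) × (ℝ × ℝ))} {p : (ℝ × ℝ) × (ℝ × ℝ)}
    (hp : p ∈ γ.support) : p.1 ∈ (γ.map Prod.fst).support := by
  rw [Measure.mem_support_iff_forall] at *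
  intro U hU
  exact (hp _ (continuous_fst.continuousAt.preimage_mem_nhds hU)).trans_le
    (Measure.le_map_apply measurable_fst.aemeasurable U)

/-- The infimum may run over an uncountable set, so measurability comes from upper semicontinuity.
-/
lemma measurable_phiG (G : Set (ℝ × ℝ)) : Measurable (phiG G) := by
  refine UpperSemicontinuous.measurable ?_
  refine upperSemicontinuous_biInf fun z _ => Continuous.upperSemicontinuous ?_
  exact continuous_coe_real_ereal.comp (by unfold covCost; fun_prop)

/-- A plan supported on minimizers over a maximal monotone set is optimal. -/
lemma isOptimalPlan_of_le {ν : Measure (ℝ × ℝ)} {γ : Measure ((ℝ × ℝ) × (ℝ × ℝ))}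
    (hγ : γ ∈ martingalePlans ν) {f : ℝ → ℝ} (hf : LipschitzWith 1 f)
    (h : ∀ᵐ p ∂γ, ∀ z ∈ rotatedGraph f, covCost p.1 p.2 ≤ covCost z p.2) :
    IsOptimalPlan ν γ := by
  refine ⟨hγ, fun ζ hζ => ?_⟩
  -- `toReal` sends -∞ to 0. This is harmless: -∞ occurs only on a ν-null set, because c(x, y) ≤
  -- φ_G(y) under γ, and ζ has the same second marginal.
  let φ : ℝ × ℝ → ℝ := fun y => (phiG (rotatedGraph f) y).toReal
  have hφm : Measurable φ := (measurable_phiG _).ereal_toReal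
  have hle : ∀ y, phiG (rotatedGraph f) y ≠ ⊥ → ∀ z ∈ rotatedGraph f, φ y ≤ covCost z y := by
    intro y hy z hz
    have h1 : phiG (rotatedGraph f) y ≤ (covCost z y : EReal) := iInf₂_le z hz
    rw [← EReal.coe_le_coe_iff]
    refine (EReal.coe_toReal ?_ hy).le.trans h1
    exact (h1.trans_lt (EReal.coe_lt_top _)).ne
  have hfin : ∀ᵐ y ∂ν, phiG (rotatedGraph f) y ≠ ⊥ := by
    have hs : MeasurableSet {y | phiG (rotatedGraph f) y ≠ ⊥} :=
      measurable_phiG _ (measurableSet_singleton ⊥).compl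
    rw [← hγ.2.1, ae_map_iff measurable_snd.aemeasurable hs]
    filter_upwards [h] with p hp hb
    have := coe_covCost_le_phiG_iff.2 hp
    rw [hb] at this
    exact absurd this (by simp)
  have hfinγ : ∀ᵐ p ∂γ, phiG (rotatedGraph f) p.2 ≠ ⊥ := by
    rw [← hγ.2.1] at hfin; exact ae_of_ae_map measurable_snd.aemeasurable hfin
  have hfinζ : ∀ᵐ p ∂ζ, phiG (rotatedGraph f) p.2 ≠ ⊥ := by
    rw [← hζ.2.1] at hfin; exact ae_of_ae_map measurable_snd.aemeasurable hfin
  have hlow : ∀ᵐ p ∂γ, covCost p.1 p.2 ≤ φ p.2 := by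
    filter_upwards [h, hfinγ] with p hp hb
    have h1 := coe_covCost_le_phiG_iff.2 hp
    have h2 : phiG (rotatedGraph f) p.2 ≤ (covCost _ p.2 : EReal) :=
      iInf₂_le _ (rotatedProj_mem f 0)
    rw [← EReal.coe_le_coe_iff]
    refine h1.trans (EReal.coe_toReal ?_ hb).ge
    exact (h2.trans_lt (EReal.coe_lt_top _)).ne
  have := hγ.1.1
  have := hζ.1.1
  have hi := integrable_covCost hγ.1.memLp_fst hγ.1.memLp_snd
  have hπ := hγ.1.memLp_rotatedProj hf
  -- φ(y) lies between c(x, y) and c(π(x), y), both integrable. Integrability then passes to ζ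
  -- through ν.
  have hφγ : Integrable (fun p => φ p.2) γ := by
    refine Integrable.mono' (hi.abs.add (integrable_covCost hπ hγ.1.memLp_snd).abs)
      (hφm.comp measurable_snd).aestronglyMeasurable ?_
    filter_upwards [hlow, hfinγ] with p h1 h2
    have h3 := hle _ h2 _ (rotatedProj_mem f p.1)
    rw [Real.norm_eq_abs, Pi.add_apply]
    have h4 := neg_abs_le (covCost p.1 p.2)
    have h5 := le_abs_self (covCost (rotatedProj f p.1) p.2)
    have h6 := abs_nonneg (covCost p.1 p.2)
    have h7 := abs_nonneg (covCost (rotatedProj f p.1) p.2)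
    exact abs_le.2 ⟨by linarith, by linarith⟩
  have hφν : Integrable φ ν := by
    rw [← hγ.2.1]
    exact (integrable_map_measure hφm.aestronglyMeasurable measurable_snd.aemeasurable).2 hφγ
  have hφζ : Integrable (fun p => φ p.2) ζ := by
    rw [← hζ.2.1] at hφν
    exact (integrable_map_measure hφm.aestronglyMeasurable measurable_snd.aemeasurable).1 hφν
  have eγ : ∫ p, φ p.2 ∂γ = ∫ y, φ y ∂ν := by
    rw [← hγ.2.1, integral_map measurable_snd.aemeasurable hφm.aestronglyMeasurable]
  have eζ : ∫ p, φ p.2 ∂ζ = ∫ y, φ y ∂ν := by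
    rw [← hζ.2.1, integral_map measurable_snd.aemeasurable hφm.aestronglyMeasurable]
  have hπζ := hζ.1.memLp_rotatedProj hf
  calc ∫ p, covCost p.1 p.2 ∂γ ≤ ∫ p, φ p.2 ∂γ := integral_mono_ae hi hφγ hlow
    _ = ∫ p, φ p.2 ∂ζ := eγ.trans eζ.symm
    _ ≤ ∫ p, covCost (rotatedProj f p.1) p.2 ∂ζ := by
      refine integral_mono_ae hφζ (integrable_covCost hπζ hζ.1.memLp_snd) ?_
      filter_upwards [hfinζ] with p hp using hle _ hp _ (rotatedProj_mem f p.1)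
    _ = ∫ p, covCost p.1 p.2 ∂ζ + ∫ p, covCost (rotatedProj f p.1) p.1 ∂ζ :=
      integral_covCost_comp_fst hζ (continuous_rotatedProj hf.continuous).measurable hπζ
    _ ≤ ∫ p, covCost p.1 p.2 ∂ζ := by
      have : ∫ p, covCost (rotatedProj f p.1) p.1 ∂ζ ≤ 0 :=
        integral_nonpos fun p => covCost_rotatedProj_nonpos f p.1
      linarith

/-! ### Perturbation of an optimal plan. -/

/-- Replacing the first marginal by a conditional expectation of the second turns any coupling
into a martingale plan. -/
lemma exists_map_mem_martingalePlans {ν : Measure (ℝ × ℝ)} {ρ : Measure ((ℝ × ℝ) × (ℝ × ℝ))}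
    (hρ : HasP2 ρ) (hν : ρ.map Prod.snd = ν) :
    ∃ g : ℝ × ℝ → ℝ × ℝ, Measurable g ∧
      MemLp (fun p : (ℝ × ℝ) × (ℝ × ℝ) => g p.1) 2 ρ ∧
      ρ.map (fun p => (g p.1, p.2)) ∈ martingalePlans ν ∧
      ∀ ψ : ℝ × ℝ → ℝ, Measurable ψ →
        MemLp (fun p : (ℝ × ℝ) × (ℝ × ℝ) => ψ p.1) 2 ρ →
        ∫ p, ψ p.1 * (p.2.1 - (g p.1).1) ∂ρ = 0 ∧ ∫ p, ψ p.1 * (p.2.2 - (g p.1).2) ∂ρ = 0 := by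
  have := hρ.1
  have hi : Integrable (Prod.snd : (ℝ × ℝ) × (ℝ × ℝ) → ℝ × ℝ) ρ :=
    hρ.memLp_snd.integrable one_le_two
  -- The conditional expectation of y factors through x as g(x).
  obtain ⟨g, hg, hge⟩ := (stronglyMeasurable_condExp (μ := ρ)
    (m := MeasurableSpace.comap (Prod.fst : (ℝ × ℝ) × (ℝ × ℝ) → ℝ × ℝ) inferInstance)
    (f := (Prod.snd : (ℝ × ℝ) × (ℝ × ℝ) → ℝ × ℝ))).measurable.exists_eq_measurable_comp
  have hg2 : MemLp (fun p : (ℝ × ℝ) × (ℝ × ℝ) => g p.1) 2 ρ := by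
    have := MemLp.condExp (m := MeasurableSpace.comap
      (Prod.fst : (ℝ × ℝ) × (ℝ × ℝ) → ℝ × ℝ) inferInstance) one_le_two hρ.memLp_snd
    rwa [hge] at this
  have hT : Measurable (fun p : (ℝ × ℝ) × (ℝ × ℝ) => (g p.1, p.2)) := by fun_prop
  have test : ∀ ψ : ℝ × ℝ → ℝ, Measurable ψ →
      MemLp (fun p : (ℝ × ℝ) × (ℝ × ℝ) => ψ p.1) 2 ρ →
      ∫ p, ψ p.1 * (p.2.1 - (g p.1).1) ∂ρ = 0 ∧ ∫ p, ψ p.1 * (p.2.2 - (g p.1).2) ∂ρ = 0 := by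
    intro ψ hψ hψ2
    have hk : StronglyMeasurable[MeasurableSpace.comap
        (Prod.fst : (ℝ × ℝ) × (ℝ × ℝ) → ℝ × ℝ) inferInstance]
        (fun p : (ℝ × ℝ) × (ℝ × ℝ) => ψ p.1) :=
      (hψ.comp (comap_measurable _)).stronglyMeasurable
    constructor
    · refine integral_mul_sub_condExp measurable_fst.comap_le hρ.memLp_snd_fst ?_ hk hψ2
      refine (fst_condExp hi).trans (Filter.Eventually.of_forall fun p => ?_)
      simp [hge]
    · refine integral_mul_sub_condExp measurable_fst.comap_le hρ.memLp_snd_snd ?_ hk hψ2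
      refine (snd_condExp hi).trans (Filter.Eventually.of_forall fun p => ?_)
      simp [hge]
  refine ⟨g, hg, hg2, ?_, test⟩
  have hid : MemLp id 2 (ρ.map (fun p : (ℝ × ℝ) × (ℝ × ℝ) => (g p.1, p.2))) := by
    refine (memLp_map_measure_iff aestronglyMeasurable_id hT.aemeasurable).2 ?_
    refine (hg2.norm.add hρ.memLp_snd.norm).mono hT.aestronglyMeasurable
      (Filter.Eventually.of_forall fun p => ?_)
    have h : (0 : ℝ) ≤ ‖g p.1‖ + ‖p.2‖ := by positivity
    simp only [Function.comp_apply, id, Pi.add_apply]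
    rw [Real.norm_of_nonneg h, Prod.norm_def]
    exact max_le (le_add_of_nonneg_right (norm_nonneg _)) (le_add_of_nonneg_left (norm_nonneg _))
  have hind : ∀ s : Set (ℝ × ℝ), MeasurableSet s →
      MemLp (fun p : (ℝ × ℝ) × (ℝ × ℝ) => (g ⁻¹' s).indicator (fun _ => (1 : ℝ)) p.1) 2 ρ := by
    intro s hs
    refine MemLp.of_bound ((measurable_const.indicator (hg hs)).comp
      measurable_fst).aestronglyMeasurable 1 (Filter.Eventually.of_forall fun p => ?_)
    by_cases h : p.1 ∈ g ⁻¹' s <;> simp [h]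
  -- Events of the new first coordinate pull back to events {g(x) ∈ s}, whose indicators are
  -- functions of x and hence admissible tests.
  have conv : ∀ s : Set (ℝ × ℝ), MeasurableSet s → ∀ A B : (ℝ × ℝ) × (ℝ × ℝ) → ℝ,
      Integrable A ρ → Integrable B ρ →
      ∫ p, (g ⁻¹' s).indicator (fun _ => (1 : ℝ)) p.1 * (A p - B p) ∂ρ = 0 →
      ∫ p in (fun p : (ℝ × ℝ) × (ℝ × ℝ) => g p.1) ⁻¹' s, B p ∂ρ =
        ∫ p in (fun p : (ℝ × ℝ) × (ℝ × ℝ) => g p.1) ⁻¹' s, A p ∂ρ := by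
    intro s hs A B hA hB h0
    have hms : MeasurableSet ((fun p : (ℝ × ℝ) × (ℝ × ℝ) => g p.1) ⁻¹' s) :=
      (hg.comp measurable_fst) hs
    have e : ∀ p : (ℝ × ℝ) × (ℝ × ℝ), (g ⁻¹' s).indicator (fun _ => (1 : ℝ)) p.1 * (A p - B p) =
        ((fun p : (ℝ × ℝ) × (ℝ × ℝ) => g p.1) ⁻¹' s).indicator (fun p => A p - B p) p := by
      intro p
      by_cases h : g p.1 ∈ s <;> simp [h]
    simp_rw [e] at h0
    rw [integral_indicator hms, integral_sub hA.integrableOn hB.integrableOn] at h0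
    linarith
  refine mem_martingalePlans_of_setIntegral
    ⟨Measure.isProbabilityMeasure_map hT.aemeasurable, hid⟩ ?_ ?_ ?_
  · rw [Measure.map_map measurable_snd hT]; exact hν
  · intro s hs
    rw [setIntegral_map (measurable_fst hs) (by fun_prop) hT.aemeasurable,
      setIntegral_map (measurable_fst hs) (by fun_prop) hT.aemeasurable]
    exact conv s hs _ _ (hρ.memLp_snd_fst.integrable one_le_two)
      ((MemLp.fst_real hg2).integrable one_le_two)
      (test _ (measurable_const.indicator (hg hs)) (hind s hs)).1
  · intro s hs
    rw [setIntegral_map (measurable_fst hs) (by fun_prop) hT.aemeasurable,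
      setIntegral_map (measurable_fst hs) (by fun_prop) hT.aemeasurable]
    exact conv s hs _ _ (hρ.memLp_snd_snd.integrable one_le_two)
      ((MemLp.snd_real hg2).integrable one_le_two)
      (test _ (measurable_const.indicator (hg hs)) (hind s hs)).2

/-- The coupling that moves the `v`-part of the first coordinates of `γ` to the point `w`. -/
noncomputable def splitPlan (γ : Measure ((ℝ × ℝ) × (ℝ × ℝ))) (v : (ℝ × ℝ) × (ℝ × ℝ) → ℝ)
    (w : ℝ × ℝ) : Measure ((ℝ × ℝ) × (ℝ × ℝ)) :=
  γ.withDensity (fun p => ENNReal.ofReal (1 - v p)) +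
    (γ.withDensity (fun p => ENNReal.ofReal (v p))).map (fun p => (w, p.2))

section SplitPlan

variable {γ : Measure ((ℝ × ℝ) × (ℝ × ℝ))} {v : (ℝ × ℝ) × (ℝ × ℝ) → ℝ} {w : ℝ × ℝ}

lemma withDensity_add_withDensity_one_sub (hv : Measurable v) (h0 : ∀ p, 0 ≤ v p)
    (h1 : ∀ p, v p ≤ 1) :
    γ.withDensity (fun p => ENNReal.ofReal (1 - v p)) +
      γ.withDensity (fun p => ENNReal.ofReal (v p)) = γ := by
  rw [← withDensity_add_left (by fun_prop)]
  have : ((fun p => ENNReal.ofReal (1 - v p)) + fun p => ENNReal.ofReal (v p)) = 1 := by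
    funext p
    rw [Pi.add_apply, ← ENNReal.ofReal_add (sub_nonneg.2 (h1 p)) (h0 p)]
    simp
  rw [this, withDensity_one]

lemma splitPlan_map_snd (hv : Measurable v) (h0 : ∀ p, 0 ≤ v p) (h1 : ∀ p, v p ≤ 1) :
    (splitPlan γ v w).map Prod.snd = γ.map Prod.snd := by
  have hT : Measurable (fun p : (ℝ × ℝ) × (ℝ × ℝ) => (w, p.2)) := by fun_prop
  rw [splitPlan, Measure.map_add _ _ measurable_snd, Measure.map_map measurable_snd hT]
  change _ + Measure.map Prod.snd _ = _
  rw [← Measure.map_add _ _ measurable_snd, withDensity_add_withDensity_one_sub hv h0 h1]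

lemma integrable_splitPlan (hv : Measurable v) (h0 : ∀ p, 0 ≤ v p) (h1 : ∀ p, v p ≤ 1)
    {F : (ℝ × ℝ) × (ℝ × ℝ) → ℝ} (hFm : Measurable F) (hF : Integrable F γ)
    (hFw : Integrable (fun p => F (w, p.2)) γ) :
    Integrable F (splitPlan γ v w) ∧
    ∫ p, F p ∂(splitPlan γ v w) = ∫ p, (1 - v p) * F p ∂γ + ∫ p, v p * F (w, p.2) ∂γ := by
  have hT : Measurable (fun p : (ℝ × ℝ) × (ℝ × ℝ) => (w, p.2)) := by fun_prop
  have hle := withDensity_add_withDensity_one_sub (γ := γ) hv h0 h1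
  have i₁ : Integrable F (γ.withDensity (fun p => ENNReal.ofReal (1 - v p))) :=
    hF.mono_measure ((Measure.le_add_right le_rfl).trans hle.le)
  have i₂ : Integrable (fun p => F (w, p.2)) (γ.withDensity (fun p => ENNReal.ofReal (v p))) :=
    hFw.mono_measure ((Measure.le_add_left le_rfl).trans hle.le)
  have i₃ : Integrable F ((γ.withDensity (fun p => ENNReal.ofReal (v p))).map
      (fun p => (w, p.2))) :=
    (integrable_map_measure hFm.aestronglyMeasurable hT.aemeasurable).2 i₂
  refine ⟨integrable_add_measure.2 ⟨i₁, i₃⟩, ?_⟩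
  rw [splitPlan, integral_add_measure i₁ i₃,
    integral_map hT.aemeasurable hFm.aestronglyMeasurable,
    integral_withDensity_eq_integral_toReal_smul (by fun_prop) (by simp),
    integral_withDensity_eq_integral_toReal_smul (by fun_prop) (by simp)]
  congr 1
  · refine integral_congr_ae (Filter.Eventually.of_forall fun p => ?_)
    simp only [smul_eq_mul]
    rw [ENNReal.toReal_ofReal (sub_nonneg.2 (h1 p))]
  · refine integral_congr_ae (Filter.Eventually.of_forall fun p => ?_)
    simp only [smul_eq_mul]
    rw [ENNReal.toReal_ofReal (h0 p)]

lemma HasP2.splitPlan (hγ : HasP2 γ) (hv : Measurable v) (h0 : ∀ p, 0 ≤ v p)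
    (h1 : ∀ p, v p ≤ 1) : HasP2 (splitPlan γ v w) := by
  have := hγ.1
  have hmap := splitPlan_map_snd (γ := γ) (w := w) hv h0 h1
  constructor
  · have h2 := congrArg (fun m => m Set.univ) hmap
    simp only [Measure.map_apply measurable_snd MeasurableSet.univ, Set.preimage_univ,
      measure_univ] at h2
    exact ⟨h2⟩
  · have key : ∀ F : (ℝ × ℝ) × (ℝ × ℝ) → ℝ, Measurable F → MemLp F 2 γ →
        MemLp (fun p => F (w, p.2)) 2 γ → MemLp F 2 (_root_.splitPlan γ v w) := by
      intro F hFm hF hFw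
      rw [memLp_two_iff_integrable_sq hFm.aestronglyMeasurable]
      exact (integrable_splitPlan hv h0 h1 (hFm.pow_const 2) hF.integrable_sq
        hFw.integrable_sq).1
    have k₁ := memLp_prodMk (key (fun p => p.1.1) (by fun_prop) hγ.memLp_fst_fst (memLp_const w.1))
      (key (fun p => p.1.2) (by fun_prop) hγ.memLp_fst_snd (memLp_const w.2))
    have k₂ := memLp_prodMk (key (fun p => p.2.1) (by fun_prop) hγ.memLp_snd_fst hγ.memLp_snd_fst)
      (key (fun p => p.2.2) (by fun_prop) hγ.memLp_snd_snd hγ.memLp_snd_snd)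
    refine (k₁.norm.add k₂.norm).mono aestronglyMeasurable_id
      (Filter.Eventually.of_forall fun p => ?_)
    simp only [id, Pi.add_apply]
    have h : (0 : ℝ) ≤ ‖(p.1.1, p.1.2)‖ + ‖(p.2.1, p.2.2)‖ := by positivity
    rw [Real.norm_of_nonneg h, Prod.norm_def]
    exact max_le (le_add_of_nonneg_right (norm_nonneg _)) (le_add_of_nonneg_left (norm_nonneg _))

/-- At least half of the mass stays in place. This carries square integrability of g from the
perturbed coupling back to γ. -/
lemma le_two_smul_splitPlan (hv : Measurable v) (h1 : ∀ p, v p ≤ 1 / 2) :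
    γ ≤ (2 : ENNReal) • splitPlan γ v w := by
  calc γ = γ.withDensity 1 := withDensity_one.symm
    _ ≤ γ.withDensity ((2 : ENNReal) • fun p => ENNReal.ofReal (1 - v p)) := by
      refine withDensity_mono (Filter.Eventually.of_forall fun p => ?_)
      simp only [Pi.one_apply, Pi.smul_apply, smul_eq_mul]
      rw [show (2 : ENNReal) = ENNReal.ofReal 2 by simp, ← ENNReal.ofReal_mul (by norm_num),
        ← ENNReal.ofReal_one]
      exact ENNReal.ofReal_le_ofReal (by linarith [h1 p])
    _ = (2 : ENNReal) • γ.withDensity (fun p => ENNReal.ofReal (1 - v p)) :=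
      withDensity_smul _ (by fun_prop)
    _ ≤ (2 : ENNReal) • splitPlan γ v w := by
      gcongr
      exact Measure.le_add_right le_rfl

end SplitPlan

/-- If the drift of a perturbed coupling is tested against itself, its square integral is of
second order in the size of the perturbation. -/
lemma drift_sq_le {α : Type*} [MeasurableSpace α] {μ : Measure α} [IsProbabilityMeasure μ]
    {v a ψ : α → ℝ} (hv : Measurable v) (hv0 : ∀ p, 0 ≤ v p) (hv1 : ∀ p, v p ≤ 1 / 2)
    {K r S : ℝ} (hva : ∀ p, |v p * a p| ≤ K) (hψ : MemLp ψ 2 μ) (ha : MemLp a 2 μ)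
    (h0 : ∫ p, ψ p * a p ∂μ = 0) (hr : 0 ≤ r)
    (hS : S = ∫ p, (1 - v p) * ψ p ^ 2 ∂μ + r)
    (hS' : S = ∫ p, (1 - v p) * (ψ p * a p) ∂μ) :
    S ≤ 2 * K ^ 2 := by
  have i₁ : Integrable (fun p => ψ p * a p) μ := hψ.integrable_mul ha
  have hvb : ∀ᵐ p ∂μ, ‖v p‖ ≤ 1 := Filter.Eventually.of_forall fun p => by
    rw [Real.norm_of_nonneg (hv0 p)]; linarith [hv1 p]
  have i₂ : Integrable (fun p => v p * (ψ p * a p)) μ :=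
    i₁.bdd_mul hv.aestronglyMeasurable hvb
  have i₃ : Integrable (fun p => v p * ψ p ^ 2) μ :=
    hψ.integrable_sq.bdd_mul hv.aestronglyMeasurable hvb
  have i₄ : Integrable (fun p => ψ p ^ 2) μ := hψ.integrable_sq
  have e₁ : ∫ p, (1 - v p) * (ψ p * a p) ∂μ = -∫ p, v p * (ψ p * a p) ∂μ := by
    simp_rw [sub_mul, one_mul]
    rw [integral_sub i₁ i₂, h0, zero_sub]
  -- Young's inequality -(va)ψ ≤ (va)² + ψ²/4. The quarter is absorbed at the end, because 1 - v ≥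
  -- 1/2 yields ∫ ψ² ≤ 2S.
  have e₂ : -∫ p, v p * (ψ p * a p) ∂μ ≤ K ^ 2 + (∫ p, ψ p ^ 2 ∂μ) / 4 := by
    rw [← integral_neg]
    calc ∫ p, -(v p * (ψ p * a p)) ∂μ ≤ ∫ p, (K ^ 2 + ψ p ^ 2 / 4) ∂μ := by
          refine integral_mono i₂.neg ((integrable_const _).add (i₄.div_const 4)) fun p => ?_
          have h1 : (v p * a p) ^ 2 ≤ K ^ 2 := by
            rw [← sq_abs]; have := hva p; gcongr
          simp only
          nlinarith [sq_nonneg (v p * a p + ψ p / 2)]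
      _ = K ^ 2 + (∫ p, ψ p ^ 2 ∂μ) / 4 := by
          rw [integral_add (integrable_const _) (i₄.div_const 4), integral_div]
          simp
  have e₃ : (∫ p, ψ p ^ 2 ∂μ) / 2 ≤ ∫ p, (1 - v p) * ψ p ^ 2 ∂μ := by
    rw [← integral_div]
    refine integral_mono (i₄.div_const 2) ?_ fun p => ?_
    · simp_rw [sub_mul, one_mul]; exact i₄.sub i₃
    · simp only
      nlinarith [sq_nonneg (ψ p), hv1 p, mul_nonneg (sub_nonneg.2 (hv1 p)) (sq_nonneg (ψ p))]
  linarith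

lemma le_of_forall_mul_le_sq {a C ε₀ : ℝ} (hε₀ : 0 < ε₀)
    (h : ∀ ε, 0 < ε → ε ≤ ε₀ → ε * a ≤ C * ε ^ 2) : a ≤ 0 := by
  have lim : Filter.Tendsto (fun ε : ℝ => C * ε) (nhdsWithin 0 (Set.Ioi 0)) (nhds (C * 0)) :=
    (Continuous.tendsto (by fun_prop) 0).mono_left nhdsWithin_le_nhds
  rw [mul_zero] at lim
  refine ge_of_tendsto lim ?_
  filter_upwards [Ioc_mem_nhdsGT hε₀] with ε hε
  have := h ε hε.1 hε.2
  rw [sq, ← mul_assoc, mul_comm ε a] at this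
  exact le_of_mul_le_mul_right this hε.1

/-- First order optimality condition: concentrating a bounded portion `h` of an optimal plan at
its barycentre does not decrease the cost. -/
lemma IsOptimalPlan.integral_mul_covCost_le {ν : Measure (ℝ × ℝ)}
    {γ : Measure ((ℝ × ℝ) × (ℝ × ℝ))} (hopt : IsOptimalPlan ν γ)
    {h : (ℝ × ℝ) × (ℝ × ℝ) → ℝ} (hm : Measurable h) (h0 : ∀ p, 0 ≤ h p) {H M : ℝ}
    (hH : ∀ p, h p ≤ H) (hM : ∀ p, h p ≠ 0 → ‖p‖ ≤ M) (h1 : ∫ p, h p ∂γ = 1) :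
    ∫ p, h p * covCost p.1 p.2 ∂γ ≤
      ∫ p, h p * (p.2.1 * p.2.2) ∂γ - (∫ p, h p * p.2.1 ∂γ) * ∫ p, h p * p.2.2 ∂γ := by
  obtain ⟨hγ, hmin⟩ := hopt
  have hP := hγ.1
  have := hP.1
  have hH0 : 0 ≤ H := (h0 0).trans (hH 0)
  have hb : ∀ᵐ p ∂γ, ‖h p‖ ≤ H := Filter.Eventually.of_forall fun p => by
    rw [Real.norm_of_nonneg (h0 p)]; exact hH p
  have hint : ∀ {F : (ℝ × ℝ) × (ℝ × ℝ) → ℝ}, Integrable F γ →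
      Integrable (fun p => h p * F p) γ := fun hF => hF.bdd_mul hm.aestronglyMeasurable hb
  set w : ℝ × ℝ := (∫ p, h p * p.2.1 ∂γ, ∫ p, h p * p.2.2 ∂γ) with hw
  have iy₁ := hint (hP.memLp_snd_fst.integrable one_le_two)
  have iy₂ := hint (hP.memLp_snd_snd.integrable one_le_two)
  have ih : Integrable h γ := by simpa using hint (integrable_const (1 : ℝ))
  have iyy : Integrable (fun p : (ℝ × ℝ) × (ℝ × ℝ) => h p * (p.2.1 * p.2.2)) γ :=
    hint (hP.memLp_snd_fst.integrable_mul hP.memLp_snd_snd)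
  have ic := integrable_covCost hP.memLp_fst hP.memLp_snd
  have icw : Integrable (fun p : (ℝ × ℝ) × (ℝ × ℝ) => covCost w p.2) γ :=
    integrable_covCost (memLp_const w) hP.memLp_snd
  have ew : ∫ p, h p * covCost w p.2 ∂γ = ∫ p, h p * (p.2.1 * p.2.2) ∂γ - w.1 * w.2 := by
    have e : ∀ p : (ℝ × ℝ) × (ℝ × ℝ), h p * covCost w p.2 =
        (h p * (p.2.1 * p.2.2) - w.1 * (h p * p.2.2)) - w.2 * (h p * p.2.1) +
          w.1 * w.2 * h p := by
      intro p; simp only [covCost]; ring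
    simp_rw [e]
    have k₁ : Integrable (fun p => h p * (p.2.1 * p.2.2) - w.1 * (h p * p.2.2)) γ :=
      iyy.sub (iy₂.const_mul _)
    have k₂ : Integrable (fun p => h p * (p.2.1 * p.2.2) - w.1 * (h p * p.2.2) -
      w.2 * (h p * p.2.1)) γ := k₁.sub (iy₁.const_mul _)
    rw [integral_add k₂ (ih.const_mul _), integral_sub k₁ (iy₁.const_mul _), integral_sub iyy (iy₂.const_mul _), integral_const_mul, integral_const_mul,
      integral_const_mul, h1]
    simp only [hw]; ring
  have ic' := hint ic
  have icw' := hint icw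
  suffices hs : ∫ p, h p * covCost p.1 p.2 ∂γ - ∫ p, h p * covCost w p.2 ∂γ ≤ 0 by
    rw [ew] at hs; linarith
  -- This ε₀ ensures εh ≤ 1/2, the added 1 covering H = 0. The constant C is the drift bound, with
  -- |y - x| ≤ 2M wherever h ≠ 0.
  refine le_of_forall_mul_le_sq (ε₀ := 1 / (2 * (H + 1))) (C := 2 * (H * (2 * M)) ^ 2)
    (by positivity) fun ε hε hε₀ => ?_
  have hεH : ε * H ≤ 1 / 2 := by
    rw [le_div_iff₀ (by positivity)] at hε₀
    nlinarith
  let v : (ℝ × ℝ) × (ℝ × ℝ) → ℝ := fun p => ε * h p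
  have hv : Measurable v := hm.const_mul ε
  have hv0 : ∀ p, 0 ≤ v p := fun p => mul_nonneg hε.le (h0 p)
  have hv2 : ∀ p, v p ≤ 1 / 2 := fun p =>
    (mul_le_mul_of_nonneg_left (hH p) hε.le).trans hεH
  have hv1 : ∀ p, v p ≤ 1 := fun p => (hv2 p).trans (by norm_num)
  let ρ := splitPlan γ v w
  have hρ : HasP2 ρ := hP.splitPlan hv hv0 hv1
  have hρν : ρ.map Prod.snd = ν := (splitPlan_map_snd hv hv0 hv1).trans hγ.2.1
  obtain ⟨g, hg, hg2, hζ, test⟩ := exists_map_mem_martingalePlans hρ hρν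
  have hgγ : MemLp (fun p : (ℝ × ℝ) × (ℝ × ℝ) => g p.1) 2 γ :=
    hg2.of_measure_le_smul (by simp) (le_two_smul_splitPlan hv hv2)
  have hle : ∫ p, covCost p.1 p.2 ∂γ ≤ ∫ p, covCost (g p.1) p.2 ∂ρ := by
    refine (hmin _ hζ).trans ?_
    rw [integral_map (by fun_prop) (Measurable.aestronglyMeasurable
      (by unfold covCost; fun_prop))]
  have hpyth : ∫ p, covCost p.1 p.2 ∂ρ =
      ∫ p, covCost (g p.1) p.2 ∂ρ + ∫ p, covCost p.1 (g p.1) ∂ρ := by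
    refine integral_covCost_eq_add hg2 hρ.memLp_snd hρ.memLp_fst ?_ ?_
    · exact (test (fun z => z.2 - (g z).2) (by fun_prop)
        (MemLp.snd_real (hρ.memLp_fst.sub hg2))).1
    · exact (test (fun z => z.1 - (g z).1) (by fun_prop)
        (MemLp.fst_real (hρ.memLp_fst.sub hg2))).2
  have hcm : Measurable (fun p : (ℝ × ℝ) × (ℝ × ℝ) => covCost p.1 p.2) := by
    unfold covCost; fun_prop
  have hsplit : ∫ p, covCost p.1 p.2 ∂ρ = ∫ p, covCost p.1 p.2 ∂γ -
      ε * ∫ p, h p * covCost p.1 p.2 ∂γ + ε * ∫ p, h p * covCost w p.2 ∂γ := by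
    rw [(integrable_splitPlan hv hv0 hv1 hcm ic icw).2]
    have e₁ : ∀ p : (ℝ × ℝ) × (ℝ × ℝ), (1 - v p) * covCost p.1 p.2 =
        covCost p.1 p.2 - ε * (h p * covCost p.1 p.2) := fun p => by simp only [v]; ring
    have e₂ : ∀ p : (ℝ × ℝ) × (ℝ × ℝ), v p * covCost w p.2 =
        ε * (h p * covCost w p.2) := fun p => by simp only [v]; ring
    rw [integral_congr_ae (Filter.Eventually.of_forall e₁),
      integral_congr_ae (Filter.Eventually.of_forall e₂), integral_sub ic (ic'.const_mul _), integral_const_mul, integral_const_mul]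
  -- One coordinate of the drift ψ = g(x) - x. It is orthogonal to y - x under γ, and under ρ its
  -- product with y - x integrates to ∫ ψ².
  have drift : ∀ (x y : (ℝ × ℝ) × (ℝ × ℝ) → ℝ) (ψ : ℝ × ℝ → ℝ) (b : ℝ),
      Measurable x → Measurable y → MemLp x 2 γ → MemLp y 2 γ → MemLp x 2 ρ → MemLp y 2 ρ →
      (∀ p, ‖x p‖ ≤ ‖p‖) → (∀ p, ‖y p‖ ≤ ‖p‖) →
      (∀ p : (ℝ × ℝ) × (ℝ × ℝ), x (w, p.2) = b) → (∀ p, y (w, p.2) = y p) →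
      b = ∫ p, h p * y p ∂γ →
      Measurable ψ → MemLp (fun p : (ℝ × ℝ) × (ℝ × ℝ) => ψ p.1) 2 γ →
      MemLp (fun p : (ℝ × ℝ) × (ℝ × ℝ) => ψ p.1) 2 ρ →
      ∫ p, ψ p.1 * (y p - x p) ∂γ = 0 →
      ∫ p, ψ p.1 * (y p - (x p + ψ p.1)) ∂ρ = 0 →
      ∫ p, ψ p.1 ^ 2 ∂ρ ≤ 2 * (ε * (H * (2 * M))) ^ 2 := by
    intro x y ψ b mx my hx hy hxρ hyρ nx ny hxw hyw hbw mψ hψ hψρ t₁ t₂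
    have iψρ : Integrable (fun p : (ℝ × ℝ) × (ℝ × ℝ) => ψ p.1 ^ 2) ρ := hψρ.integrable_sq
    have icross : Integrable (fun p => ψ p.1 * (y p - x p)) γ := hψ.integrable_mul (hy.sub hx)
    have icrossρ : Integrable (fun p => ψ p.1 * (y p - x p)) ρ := hψρ.integrable_mul (hyρ.sub hxρ)
    have eS : ∫ p, ψ p.1 ^ 2 ∂ρ = ∫ p, ψ p.1 * (y p - x p) ∂ρ := by
      have e : ∀ p, ψ p.1 * (y p - (x p + ψ p.1)) = ψ p.1 * (y p - x p) - ψ p.1 ^ 2 := by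
        intro p; ring
      simp_rw [e] at t₂
      rw [integral_sub icrossρ iψρ] at t₂
      linarith
    have sq := (integrable_splitPlan (w := w) hv hv0 hv1 (F := fun p => ψ p.1 ^ 2)
      (by fun_prop) hψ.integrable_sq (integrable_const (ψ w ^ 2))).2
    have hw2 : Integrable (fun p => ψ w * (y (w, p.2) - x (w, p.2))) γ := by
      simp_rw [hxw, hyw]
      exact ((hy.integrable one_le_two).sub (integrable_const b)).const_mul _
    have cr := (integrable_splitPlan hv hv0 hv1 (F := fun p => ψ p.1 * (y p - x p))
      (by fun_prop) icross hw2).2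
    -- The mass moved to `w` contributes nothing, since `w` is its barycentre.
    have hz : ∫ p, v p * (ψ w * (y (w, p.2) - x (w, p.2))) ∂γ = 0 := by
      have e : ∀ p : (ℝ × ℝ) × (ℝ × ℝ), v p * (ψ w * (y (w, p.2) - x (w, p.2))) =
          ε * ψ w * (h p * y p - b * h p) := by
        intro p; rw [hxw, hyw]; simp only [v]; ring
      rw [integral_congr_ae (Filter.Eventually.of_forall e), integral_const_mul, integral_sub (hint (hy.integrable one_le_two)) (ih.const_mul b),
        integral_const_mul, h1, ← hbw]
      ring
    rw [hz, add_zero] at cr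
    refine drift_sq_le (a := fun p => y p - x p) (ψ := fun p => ψ p.1) hv hv0 hv2 ?_ hψ
      (hy.sub hx) t₁ (integral_nonneg fun p => mul_nonneg (hv0 p) (sq_nonneg (ψ w))) sq
      (eS.trans cr)
    intro p
    by_cases hp : h p = 0
    · simp only [v, hp, mul_zero, zero_mul, abs_zero]
      rcases eq_or_lt_of_le hH0 with hH' | hH'
      · simp [← hH']
      · by_cases hM0 : 0 ≤ M
        · positivity
        -- M < 0 would force h to vanish identically, contradicting ∫ h = 1.
        · exfalso
          have : ∀ q, h q = 0 := fun q => by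
            by_contra hq
            exact hM0 ((norm_nonneg q).trans (hM q hq))
          simp [this] at h1
    · have h3 : |y p - x p| ≤ 2 * M := by
        have := norm_sub_le (y p) (x p)
        rw [Real.norm_eq_abs (y p - x p)] at this
        linarith [nx p, ny p, hM p hp]
      rw [abs_mul, abs_of_nonneg (hv0 p)]
      change ε * h p * |y p - x p| ≤ _
      rw [mul_assoc]
      gcongr
      exact hH p
  have hψγ := hgγ.sub hP.memLp_fst
  have hψρ := hg2.sub hρ.memLp_fst
  have d₁ := drift (fun p => p.1.1) (fun p => p.2.1) (fun z => (g z).1 - z.1) w.1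
    (by fun_prop) (by fun_prop) hP.memLp_fst_fst hP.memLp_snd_fst hρ.memLp_fst_fst
    hρ.memLp_snd_fst (fun p => (norm_fst_le p.1).trans (norm_fst_le p))
    (fun p => (norm_fst_le p.2).trans (norm_snd_le p)) (fun _ => rfl) (fun _ => rfl) rfl
    (by fun_prop) (MemLp.fst_real hψγ) (MemLp.fst_real hψρ)
    (integral_mul_sub_eq_zero_of_mem hγ (ψ := fun z => (g z).1 - z.1) (by fun_prop)
      (MemLp.fst_real hψγ)).1
    (by simpa only [add_sub_cancel] using (test (fun z => (g z).1 - z.1) (by fun_prop)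
      (MemLp.fst_real hψρ)).1)
  have d₂ := drift (fun p => p.1.2) (fun p => p.2.2) (fun z => (g z).2 - z.2) w.2
    (by fun_prop) (by fun_prop) hP.memLp_fst_snd hP.memLp_snd_snd hρ.memLp_fst_snd
    hρ.memLp_snd_snd (fun p => (norm_snd_le p.1).trans (norm_fst_le p))
    (fun p => (norm_snd_le p.2).trans (norm_snd_le p)) (fun _ => rfl) (fun _ => rfl) rfl
    (by fun_prop) (MemLp.snd_real hψγ) (MemLp.snd_real hψρ)
    (integral_mul_sub_eq_zero_of_mem hγ (ψ := fun z => (g z).2 - z.2) (by fun_prop)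
      (MemLp.snd_real hψγ)).2
    (by simpa only [add_sub_cancel] using (test (fun z => (g z).2 - z.2) (by fun_prop)
      (MemLp.snd_real hψρ)).2)
  have hrem : -∫ p, covCost p.1 (g p.1) ∂ρ ≤ 2 * (ε * (H * (2 * M))) ^ 2 := by
    have j₁ : Integrable (fun p : (ℝ × ℝ) × (ℝ × ℝ) => ((g p.1).1 - p.1.1) ^ 2) ρ :=
      (MemLp.fst_real hψρ).integrable_sq
    have j₂ : Integrable (fun p : (ℝ × ℝ) × (ℝ × ℝ) => ((g p.1).2 - p.1.2) ^ 2) ρ :=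
      (MemLp.snd_real hψρ).integrable_sq
    have : ∫ p, -covCost p.1 (g p.1) ∂ρ ≤
        ∫ p, (((g p.1).1 - p.1.1) ^ 2 / 2 + ((g p.1).2 - p.1.2) ^ 2 / 2) ∂ρ := by
      refine integral_mono (integrable_covCost hρ.memLp_fst hg2).neg
        ((j₁.div_const 2).add (j₂.div_const 2)) fun p => ?_
      simp only [covCost]
      nlinarith [sq_nonneg (((g p.1).1 - p.1.1) + ((g p.1).2 - p.1.2))]
    rw [integral_neg, integral_add (j₁.div_const 2) (j₂.div_const 2), integral_div,
      integral_div] at this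
    linarith
  have hfin : (ε * (H * (2 * M))) ^ 2 = (H * (2 * M)) ^ 2 * ε ^ 2 := by ring
  rw [hfin] at hrem
  linarith

/-! ### Localization at two support points. -/

lemma tendsto_ball_smallSets {E : Type*} [PseudoMetricSpace E] (p : E) :
    Filter.Tendsto (fun δ : ℝ => Metric.ball p δ) (nhdsWithin 0 (Set.Ioi 0))
      (nhds p).smallSets := by
  rw [Filter.tendsto_smallSets_iff]
  intro s hs
  obtain ⟨ε, hε, hεs⟩ := Metric.mem_nhds_iff.1 hs
  filter_upwards [Ioo_mem_nhdsGT hε] with δ hδ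
  exact (Metric.ball_subset_ball hδ.2.le).trans hεs

/-- Averages of a continuous function over balls shrinking to a point of the support. -/
lemma tendsto_ball_average_of_mem_support {E : Type*} [PseudoMetricSpace E] [MeasurableSpace E]
    [OpensMeasurableSpace E] [SecondCountableTopology E] {μ : Measure E} [IsFiniteMeasure μ]
    {F : E → ℝ} (hF : Continuous F) {p : E} (hp : p ∈ μ.support) :
    Filter.Tendsto (fun δ : ℝ => (μ.real (Metric.ball p δ))⁻¹ * ∫ q in Metric.ball p δ, F q ∂μ)
      (nhdsWithin 0 (Set.Ioi 0)) (nhds (F p)) := by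
  have h := (hF.continuousAt (x := p)).integral_sub_linear_isLittleO_ae (μ := μ)
    hF.aestronglyMeasurable.stronglyMeasurableAtFilter (tendsto_ball_smallSets p)
    (fun δ => μ.real (Metric.ball p δ)) (Filter.EventuallyEq.rfl)
  have h2 := h.tendsto_div_nhds_zero.add_const (F p)
  rw [zero_add] at h2
  refine h2.congr' ?_
  filter_upwards [self_mem_nhdsWithin] with δ hδ
  have hpos : 0 < μ.real (Metric.ball p δ) :=
    ENNReal.toReal_pos ((Measure.mem_support_iff_forall p).1 hp _
      (Metric.ball_mem_nhds p hδ)).ne' (measure_ne_top _ _)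
  rw [smul_eq_mul]
  field_simp
  ring

/-- The support of an optimal plan satisfies the pairwise condition. -/
lemma IsOptimalPlan.pairwiseOptimal_support {ν : Measure (ℝ × ℝ)}
    {γ : Measure ((ℝ × ℝ) × (ℝ × ℝ))} (hopt : IsOptimalPlan ν γ) :
    PairwiseOptimal γ.support := by
  intro x₀ y₀ x₁ y₁ hp₀ hp₁ t ht
  have hP := hopt.1.1
  have := hP.1
  let p₀ := (x₀, y₀)
  let p₁ := (x₁, y₁)
  let A : ((ℝ × ℝ) × (ℝ × ℝ) → ℝ) → ℝ → ℝ := fun F δ =>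
    (1 - t) * ((γ.real (Metric.ball p₀ δ))⁻¹ * ∫ q in Metric.ball p₀ δ, F q ∂γ) +
      t * ((γ.real (Metric.ball p₁ δ))⁻¹ * ∫ q in Metric.ball p₁ δ, F q ∂γ)
  have hA : ∀ F, Continuous F →
      Filter.Tendsto (A F) (nhdsWithin 0 (Set.Ioi 0)) (nhds ((1 - t) * F p₀ + t * F p₁)) :=
    fun F hF => ((tendsto_ball_average_of_mem_support hF hp₀).const_mul _).add
      ((tendsto_ball_average_of_mem_support hF hp₁).const_mul _)
  have hineq : ∀ δ ∈ Set.Ioo (0 : ℝ) 1, A (fun p => covCost p.1 p.2) δ ≤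
      A (fun p => p.2.1 * p.2.2) δ - A (fun p => p.2.1) δ * A (fun p => p.2.2) δ := by
    intro δ hδ
    let c₀ := (1 - t) * (γ.real (Metric.ball p₀ δ))⁻¹
    let c₁ := t * (γ.real (Metric.ball p₁ δ))⁻¹
    have hc₀ : 0 ≤ c₀ := mul_nonneg (sub_nonneg.2 ht.2) (by positivity)
    have hc₁ : 0 ≤ c₁ := mul_nonneg ht.1 (by positivity)
    -- The γ-density of the mixture, with weights 1 - t and t, of γ conditioned on the two balls.
    -- The balls may overlap.
    let h : (ℝ × ℝ) × (ℝ × ℝ) → ℝ := fun p =>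
      c₀ * (Metric.ball p₀ δ).indicator (fun _ => 1) p +
        c₁ * (Metric.ball p₁ δ).indicator (fun _ => 1) p
    have hmul : ∀ F : (ℝ × ℝ) × (ℝ × ℝ) → ℝ, Integrable F γ → ∫ p, h p * F p ∂γ = A F δ := by
      intro F hF
      have e : ∀ p, h p * F p = c₀ * (Metric.ball p₀ δ).indicator F p +
          c₁ * (Metric.ball p₁ δ).indicator F p := by
        intro p
        by_cases h₀ : p ∈ Metric.ball p₀ δ <;> by_cases h₁ : p ∈ Metric.ball p₁ δ <;>
          simp only [h, Set.indicator_of_mem, Set.indicator_of_notMem, h₀, h₁, not_false_eq_true]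
            <;> ring
      simp_rw [e]
      rw [integral_add ((hF.indicator measurableSet_ball).const_mul _)
        ((hF.indicator measurableSet_ball).const_mul _), integral_const_mul, integral_const_mul,
        integral_indicator measurableSet_ball, integral_indicator measurableSet_ball]
      simp only [A, c₀, c₁]
      ring
    have hind : ∀ (s : Set ((ℝ × ℝ) × (ℝ × ℝ))) p,
        0 ≤ s.indicator (fun _ => (1 : ℝ)) p ∧ s.indicator (fun _ => (1 : ℝ)) p ≤ 1 := by
      intro s p
      by_cases h : p ∈ s <;> simp [h]
    have hone : ∫ p, h p ∂γ = 1 := by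
      have h1 := hmul (fun _ => 1) (integrable_const _)
      simp only [mul_one] at h1
      rw [h1]
      have hpos : ∀ p ∈ γ.support, γ.real (Metric.ball p δ) ≠ 0 := fun p hp =>
        (ENNReal.toReal_pos ((Measure.mem_support_iff_forall p).1 hp _
          (Metric.ball_mem_nhds p hδ.1)).ne' (measure_ne_top _ _)).ne'
      simp only [A, setIntegral_const, smul_eq_mul, mul_one]
      rw [inv_mul_cancel₀ (hpos _ hp₀), inv_mul_cancel₀ (hpos _ hp₁)]
      ring
    have := hopt.integral_mul_covCost_le (h := h) (H := c₀ + c₁) (M := ‖p₀‖ + ‖p₁‖ + 1)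
      (((measurable_const.indicator measurableSet_ball).const_mul _).add
        ((measurable_const.indicator measurableSet_ball).const_mul _))
      (fun p => add_nonneg (mul_nonneg hc₀ (hind _ p).1) (mul_nonneg hc₁ (hind _ p).1))
      (fun p => add_le_add (mul_le_of_le_one_right hc₀ (hind _ p).2)
        (mul_le_of_le_one_right hc₁ (hind _ p).2))
      (fun p hp => by
        have hnear : ∀ q, p ∈ Metric.ball q δ → ‖p‖ ≤ ‖q‖ + 1 := by
          intro q hq
          rw [mem_ball_iff_norm] at hq
          have := norm_le_norm_add_norm_sub' p q
          linarith [hδ.2]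
        by_cases h₀ : p ∈ Metric.ball p₀ δ
        · linarith [hnear _ h₀, norm_nonneg p₁]
        · by_cases h₁ : p ∈ Metric.ball p₁ δ
          · linarith [hnear _ h₁, norm_nonneg p₀]
          · exact absurd (by simp [h, h₀, h₁]) hp) hone
    rwa [hmul _ (integrable_covCost hP.memLp_fst hP.memLp_snd),
      hmul (fun p => p.2.1 * p.2.2) (hP.memLp_snd_fst.integrable_mul hP.memLp_snd_snd),
      hmul _ (hP.memLp_snd_fst.integrable one_le_two),
      hmul _ (hP.memLp_snd_snd.integrable one_le_two)] at this
  have lim := le_of_tendsto_of_tendsto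
    (hA (fun p => covCost p.1 p.2) (by unfold covCost; fun_prop))
    ((hA (fun p => p.2.1 * p.2.2) (by fun_prop)).sub
      ((hA (fun p => p.2.1) (by fun_prop)).mul (hA (fun p => p.2.2) (by fun_prop))))
    (by filter_upwards [Ioo_mem_nhdsGT one_pos] with δ hδ using hineq δ hδ)
  simp only [p₀, p₁] at lim
  -- The limit is the covariance of y₁ and y₂ under the two-point law with weights 1 - t and t,
  -- namely t(1 - t) c(y₀, y₁).
  refine lim.trans (le_of_eq ?_)
  simp only [covCost]
  ring

/-! ### Uniform quadratic tails. -/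

/-- The part of `a` outside `[-R, R]`. -/
noncomputable def excess (R a : ℝ) : ℝ := a - max (-R) (min a R)

lemma continuous_excess (R : ℝ) : Continuous (excess R) := by unfold excess; fun_prop

lemma measurable_excess (R : ℝ) : Measurable (excess R) := (continuous_excess R).measurable

lemma excess_of_abs_le {R a : ℝ} (h : |a| ≤ R) : excess R a = 0 := by
  rw [abs_le] at h
  rw [excess, min_eq_left h.2, max_eq_right h.1, sub_self]

lemma abs_excess {R : ℝ} (hR : 0 ≤ R) (a : ℝ) : |excess R a| = max (|a| - R) 0 := by
  unfold excess
  rcases le_total a R with h | h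
  · rw [min_eq_left h]
    rcases le_total (-R) a with h' | h'
    · rw [max_eq_right h', sub_self, abs_zero, max_eq_right]
      linarith [abs_le.2 ⟨h', h⟩]
    · rw [max_eq_left h', abs_of_nonpos (by linarith : a ≤ 0), max_eq_left (by linarith),
        abs_of_nonpos (by linarith)]
      ring
  · rw [min_eq_right h, max_eq_right (by linarith), abs_of_nonneg (by linarith : 0 ≤ a),
      max_eq_left (by linarith), abs_of_nonneg (by linarith)]

lemma abs_excess_le {R : ℝ} (hR : 0 ≤ R) (a : ℝ) : |excess R a| ≤ |a| := by
  rw [abs_excess hR]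
  exact max_le (by linarith) (abs_nonneg a)

/-- The convexity inequality for the square of the excess. -/
lemma excess_sq_add_le {R : ℝ} (hR : 0 ≤ R) (a b : ℝ) :
    excess R a ^ 2 + 2 * (excess R a * (b - a)) ≤ excess R b ^ 2 := by
  -- The projection inequality: `excess R a` is normal to [-R, R] at the projection of a.
  have h : excess R a * (max (-R) (min b R) - max (-R) (min a R)) ≤ 0 := by
    have hb₁ : -R ≤ max (-R) (min b R) := le_max_left _ _
    have hb₂ : max (-R) (min b R) ≤ R := max_le (by linarith) (min_le_right _ _)
    unfold excess
    rcases le_total a R with h | h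
    · rw [min_eq_left h]
      rcases le_total (-R) a with h' | h'
      · rw [max_eq_right h', sub_self, zero_mul]
      · rw [max_eq_left h']
        exact mul_nonpos_of_nonpos_of_nonneg (by linarith) (by linarith)
    · rw [min_eq_right h, max_eq_right (by linarith : -R ≤ R)]
      exact mul_nonpos_of_nonneg_of_nonpos (by linarith) (by linarith)
  have e : b - a = (excess R b - excess R a) + (max (-R) (min b R) - max (-R) (min a R)) := by
    simp only [excess]; ring
  rw [e]
  nlinarith [sq_nonneg (excess R b - excess R a)]

/-- A quadratic tail function on the space of pairs. -/
noncomputable def tailFn (R : ℝ) (p : (ℝ × ℝ) × (ℝ × ℝ)) : ℝ :=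
  excess R p.1.1 ^ 2 + excess R p.1.2 ^ 2 + (excess R p.2.1 ^ 2 + excess R p.2.2 ^ 2)

lemma continuous_tailFn (R : ℝ) : Continuous (tailFn R) := by
  have := continuous_excess R
  unfold tailFn
  fun_prop

lemma tailFn_nonneg (R : ℝ) (p : (ℝ × ℝ) × (ℝ × ℝ)) : 0 ≤ tailFn R p := by
  unfold tailFn; positivity

lemma sq_max_norm_sub_le_tailFn {R : ℝ} (hR : 0 ≤ R) (p : (ℝ × ℝ) × (ℝ × ℝ)) :
    max (‖p‖ - R) 0 ^ 2 ≤ tailFn R p := by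
  have h₁ := sq_nonneg (excess R p.1.1)
  have h₂ := sq_nonneg (excess R p.1.2)
  have h₃ := sq_nonneg (excess R p.2.1)
  have h₄ := sq_nonneg (excess R p.2.2)
  have key : ∀ a, max (|a| - R) 0 ^ 2 = excess R a ^ 2 := fun a => by
    rw [← abs_excess hR, sq_abs]
  have cases4 : ‖p‖ = |p.1.1| ∨ ‖p‖ = |p.1.2| ∨ ‖p‖ = |p.2.1| ∨ ‖p‖ = |p.2.2| := by
    simp only [Prod.norm_def, Real.norm_eq_abs]
    rcases max_choice (max |p.1.1| |p.1.2|) (max |p.2.1| |p.2.2|) with h | h <;> rw [h]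
    · rcases max_choice |p.1.1| |p.1.2| with h | h <;> simp [h]
    · rcases max_choice |p.2.1| |p.2.2| with h | h <;> simp [h]
  unfold tailFn
  rcases cases4 with h | h | h | h <;> rw [h, key] <;> linarith

/-- Here ‖p‖ - R ≥ ‖p‖/2, whence the factor 4. -/
lemma norm_sq_le_tailFn {R : ℝ} (hR : 0 ≤ R) {p : (ℝ × ℝ) × (ℝ × ℝ)} (hp : 2 * R ≤ ‖p‖) :
    ‖p‖ ^ 2 ≤ 4 * tailFn R p := by
  have h := sq_max_norm_sub_le_tailFn hR p
  rw [max_eq_left (by linarith)] at h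
  nlinarith [norm_nonneg p]

lemma norm_sq_le_tailFn_zero (p : (ℝ × ℝ) × (ℝ × ℝ)) : ‖p‖ ^ 2 ≤ tailFn 0 p := by
  have h := sq_max_norm_sub_le_tailFn le_rfl p
  rwa [sub_zero, max_eq_left (norm_nonneg p)] at h

/-- The tail bound for martingale plans with second marginal `ν`. -/
noncomputable def tailBound (ν : Measure (ℝ × ℝ)) (R : ℝ) : ℝ :=
  2 * ∫ y, (excess R y.1 ^ 2 + excess R y.2 ^ 2) ∂ν

lemma memLp_excess {α : Type*} [MeasurableSpace α] {μ : Measure α} {f : α → ℝ} {R : ℝ}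
    (hR : 0 ≤ R) (hf : MemLp f 2 μ) : MemLp (fun a => excess R (f a)) 2 μ :=
  hf.mono ((continuous_excess R).comp_aestronglyMeasurable hf.1)
    (Filter.Eventually.of_forall fun a => abs_excess_le hR (f a))

lemma integrable_tailFn {γ : Measure ((ℝ × ℝ) × (ℝ × ℝ))} (hγ : HasP2 γ) {R : ℝ} (hR : 0 ≤ R) :
    Integrable (tailFn R) γ :=
  ((memLp_excess hR hγ.memLp_fst_fst).integrable_sq.add
    (memLp_excess hR hγ.memLp_fst_snd).integrable_sq).add
  ((memLp_excess hR hγ.memLp_snd_fst).integrable_sq.add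
    (memLp_excess hR hγ.memLp_snd_snd).integrable_sq)

/-- Jensen's inequality for the convex function `excess R` squared; its tangent term integrates to
zero by hypothesis. -/
lemma integral_excess_sq_le {α : Type*} [MeasurableSpace α] {μ : Measure α} {x y : α → ℝ} {R : ℝ}
    (hR : 0 ≤ R) (hx : MemLp x 2 μ) (hy : MemLp y 2 μ)
    (h : ∫ a, excess R (x a) * (y a - x a) ∂μ = 0) :
    ∫ a, excess R (x a) ^ 2 ∂μ ≤ ∫ a, excess R (y a) ^ 2 ∂μ := by
  have i₁ := (memLp_excess hR hx).integrable_sq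
  have i₂ : Integrable (fun a => 2 * (excess R (x a) * (y a - x a))) μ :=
    ((memLp_excess hR hx).integrable_mul (hy.sub hx)).const_mul 2
  calc ∫ a, excess R (x a) ^ 2 ∂μ
      = ∫ a, (excess R (x a) ^ 2 + 2 * (excess R (x a) * (y a - x a))) ∂μ := by
        rw [integral_add i₁ i₂, integral_const_mul, h, mul_zero, add_zero]
    _ ≤ ∫ a, excess R (y a) ^ 2 ∂μ :=
        integral_mono (i₁.add i₂) (memLp_excess hR hy).integrable_sq
          fun a => excess_sq_add_le hR (x a) (y a)

/-- By Jensen the x-tails are dominated by the y-tails, which explains the factor 2 in `tailBound`.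
-/
lemma integral_tailFn_le {ν : Measure (ℝ × ℝ)} {γ : Measure ((ℝ × ℝ) × (ℝ × ℝ))}
    (hγ : γ ∈ martingalePlans ν) {R : ℝ} (hR : 0 ≤ R) :
    ∫ p, tailFn R p ∂γ ≤ tailBound ν R := by
  have hP := hγ.1
  have m := measurable_excess R
  have j₁ := (memLp_excess hR hP.memLp_fst_fst).integrable_sq
  have j₂ := (memLp_excess hR hP.memLp_fst_snd).integrable_sq
  have j₃ := (memLp_excess hR hP.memLp_snd_fst).integrable_sq
  have j₄ := (memLp_excess hR hP.memLp_snd_snd).integrable_sq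
  have e₁ := integral_excess_sq_le hR hP.memLp_fst_fst hP.memLp_snd_fst
    (integral_mul_sub_eq_zero_of_mem hγ (ψ := fun z => excess R z.1) (by fun_prop)
      (memLp_excess hR hP.memLp_fst_fst)).1
  have e₂ := integral_excess_sq_le hR hP.memLp_fst_snd hP.memLp_snd_snd
    (integral_mul_sub_eq_zero_of_mem hγ (ψ := fun z => excess R z.2) (by fun_prop)
      (memLp_excess hR hP.memLp_fst_snd)).2
  have e₃ : ∫ y, (excess R y.1 ^ 2 + excess R y.2 ^ 2) ∂ν =
      ∫ p, excess R p.2.1 ^ 2 ∂γ + ∫ p, excess R p.2.2 ^ 2 ∂γ := by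
    rw [← integral_add j₃ j₄, ← hγ.2.1, integral_map measurable_snd.aemeasurable
      (Measurable.aestronglyMeasurable (by fun_prop))]
  have i₁₂ : Integrable (fun p : (ℝ × ℝ) × (ℝ × ℝ) =>
    excess R p.1.1 ^ 2 + excess R p.1.2 ^ 2) γ := j₁.add j₂
  have i₃₄ : Integrable (fun p : (ℝ × ℝ) × (ℝ × ℝ) =>
    excess R p.2.1 ^ 2 + excess R p.2.2 ^ 2) γ := j₃.add j₄
  unfold tailBound tailFn
  rw [e₃, integral_add i₁₂ i₃₄, integral_add j₁ j₂, integral_add j₃ j₄]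
  linarith

lemma tendsto_tailBound {ν : Measure (ℝ × ℝ)} (hν : HasP2 ν) :
    Filter.Tendsto (fun n : ℕ => tailBound ν n) Filter.atTop (nhds 0) := by
  have h₁ : MemLp (fun y : ℝ × ℝ => y.1) 2 ν :=
    hν.memLp_of_norm_le (by fun_prop) fun p => norm_fst_le p
  have h₂ : MemLp (fun y : ℝ × ℝ => y.2) 2 ν :=
    hν.memLp_of_norm_le (by fun_prop) fun p => norm_snd_le p
  have lim : Filter.Tendsto (fun n : ℕ => ∫ y, (excess n y.1 ^ 2 + excess n y.2 ^ 2) ∂ν)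
      Filter.atTop (nhds (∫ _, (0 : ℝ) ∂ν)) := by
    refine tendsto_integral_of_dominated_convergence (fun y => y.1 ^ 2 + y.2 ^ 2) (fun n => ?_)
      (h₁.integrable_sq.add h₂.integrable_sq) (fun n => Filter.Eventually.of_forall fun y => ?_)
      (Filter.Eventually.of_forall fun y => ?_)
    · have := measurable_excess n
      exact Measurable.aestronglyMeasurable (by fun_prop)
    · rw [Real.norm_of_nonneg (by positivity)]
      exact add_le_add (sq_le_sq.2 (abs_excess_le n.cast_nonneg _))
        (sq_le_sq.2 (abs_excess_le n.cast_nonneg _))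
    · refine tendsto_const_nhds.congr' ?_
      filter_upwards [Filter.eventually_ge_atTop ⌈‖y‖⌉₊] with n hn
      have hn' : ‖y‖ ≤ n := (Nat.le_ceil _).trans (by exact_mod_cast hn)
      rw [excess_of_abs_le ((norm_fst_le y).trans hn'),
        excess_of_abs_le ((norm_snd_le y).trans hn')]
      simp
  rw [integral_zero] at lim
  simpa [tailBound] using lim.const_mul 2

/-! ### Weak limits of martingale plans. -/

/-- Tail bounds pass to weak limits. -/
lemma integrable_tailFn_of_tendsto {γs : ℕ → ProbabilityMeasure ((ℝ × ℝ) × (ℝ × ℝ))}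
    {γ : ProbabilityMeasure ((ℝ × ℝ) × (ℝ × ℝ))} (hlim : Filter.Tendsto γs Filter.atTop (nhds γ))
    {R T : ℝ} (hi : ∀ i, Integrable (tailFn R) (γs i : Measure ((ℝ × ℝ) × (ℝ × ℝ))))
    (hT : ∀ i, ∫ p, tailFn R p ∂(γs i : Measure ((ℝ × ℝ) × (ℝ × ℝ))) ≤ T) :
    Integrable (tailFn R) (γ : Measure ((ℝ × ℝ) × (ℝ × ℝ))) ∧
      ∫ p, tailFn R p ∂(γ : Measure ((ℝ × ℝ) × (ℝ × ℝ))) ≤ T := by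
  have hopen : ∀ G, IsOpen G → (γ : Measure ((ℝ × ℝ) × (ℝ × ℝ))) G ≤
      Filter.liminf (fun i => (γs i : Measure ((ℝ × ℝ) × (ℝ × ℝ))) G) Filter.atTop :=
    fun G hG => ProbabilityMeasure.le_liminf_measure_open_of_tendsto (μ := γ) (μs := γs) hlim hG
  have h := lintegral_le_liminf_lintegral_of_forall_isOpen_measure_le_liminf_measure
    (μ := (γ : Measure ((ℝ × ℝ) × (ℝ × ℝ))))
    (μs := fun i => (γs i : Measure ((ℝ × ℝ) × (ℝ × ℝ))))
    (f := tailFn R) (continuous_tailFn R) (tailFn_nonneg R) hopen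
  have h2 : ∫⁻ p, ENNReal.ofReal (tailFn R p) ∂(γ : Measure ((ℝ × ℝ) × (ℝ × ℝ))) ≤
      ENNReal.ofReal T := by
    refine h.trans (Filter.liminf_le_of_frequently_le' (Filter.Frequently.of_forall fun i => ?_))
    rw [← ofReal_integral_eq_lintegral_ofReal (hi i)
      (Filter.Eventually.of_forall fun p => tailFn_nonneg R p)]
    exact ENNReal.ofReal_le_ofReal (hT i)
  have hT0 : 0 ≤ T := (integral_nonneg fun p => tailFn_nonneg R p).trans (hT 0)
  constructor
  · refine ⟨(continuous_tailFn R).aestronglyMeasurable, ?_⟩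
    rw [hasFiniteIntegral_iff_ofReal (Filter.Eventually.of_forall fun p => tailFn_nonneg R p)]
    exact h2.trans_lt ENNReal.ofReal_lt_top
  · rw [integral_eq_lintegral_of_nonneg_ae
      (Filter.Eventually.of_forall fun p => tailFn_nonneg R p)
      (continuous_tailFn R).aestronglyMeasurable]
    exact ENNReal.toReal_le_of_le_ofReal hT0 h2

/-- The truncation level is the growth bound at radius 2R, so an excess occurs only for ‖p‖ ≥ 2R.
There 1 ≤ ‖p‖², and C(1 + ‖p‖²) ≤ 2C‖p‖² ≤ 8C `tailFn R p`. -/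
lemma abs_excess_comp_le_tailFn {f : (ℝ × ℝ) × (ℝ × ℝ) → ℝ} {C : ℝ} (hC : 0 ≤ C)
    (hf : ∀ p, |f p| ≤ C * (1 + ‖p‖ ^ 2)) {R : ℝ} (hR : 1 ≤ R) (p : (ℝ × ℝ) × (ℝ × ℝ)) :
    |excess (C * (1 + (2 * R) ^ 2)) (f p)| ≤ 8 * C * tailFn R p := by
  have h0 := tailFn_nonneg R p
  rcases le_total ‖p‖ (2 * R) with h | h
  · have : |f p| ≤ C * (1 + (2 * R) ^ 2) := by
      refine (hf p).trans ?_
      gcongr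
    rw [excess_of_abs_le this, abs_zero]
    positivity
  · have h1 := norm_sq_le_tailFn (by linarith) h
    have h2 : 1 ≤ ‖p‖ ^ 2 := by nlinarith
    refine (abs_excess_le (by positivity) _).trans ((hf p).trans ?_)
    nlinarith

/-- Integrals of functions of quadratic growth converge along weakly convergent sequences with
uniformly small quadratic tails. -/
lemma tendsto_integral_of_tendsto_of_tailFn {γs : ℕ → ProbabilityMeasure ((ℝ × ℝ) × (ℝ × ℝ))}
    {γ : ProbabilityMeasure ((ℝ × ℝ) × (ℝ × ℝ))} (hlim : Filter.Tendsto γs Filter.atTop (nhds γ))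
    {T : ℕ → ℝ} (hT0 : Filter.Tendsto T Filter.atTop (nhds 0))
    (hi : ∀ i (n : ℕ), Integrable (tailFn n) (γs i : Measure ((ℝ × ℝ) × (ℝ × ℝ))))
    (hT : ∀ i (n : ℕ), ∫ p, tailFn n p ∂(γs i : Measure ((ℝ × ℝ) × (ℝ × ℝ))) ≤ T n)
    {f : (ℝ × ℝ) × (ℝ × ℝ) → ℝ} (hf : Continuous f) {C : ℝ} (hC : 0 ≤ C)
    (hfC : ∀ p, |f p| ≤ C * (1 + ‖p‖ ^ 2)) :
    Filter.Tendsto (fun i => ∫ p, f p ∂(γs i : Measure ((ℝ × ℝ) × (ℝ × ℝ)))) Filter.atTop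
      (nhds (∫ p, f p ∂(γ : Measure ((ℝ × ℝ) × (ℝ × ℝ))))) := by
  -- Truncating f costs at most 8C T(n), uniformly over the sequence and its limit; weak convergence
  -- handles the bounded remainder.
  have trunc : ∀ (μ : ProbabilityMeasure ((ℝ × ℝ) × (ℝ × ℝ))) (n : ℕ), 1 ≤ n →
      Integrable (tailFn n) (μ : Measure ((ℝ × ℝ) × (ℝ × ℝ))) →
      ∫ p, tailFn n p ∂(μ : Measure ((ℝ × ℝ) × (ℝ × ℝ))) ≤ T n →
      |∫ p, f p ∂(μ : Measure ((ℝ × ℝ) × (ℝ × ℝ))) -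
        ∫ p, max (-(C * (1 + (2 * (n : ℝ)) ^ 2))) (min (f p) (C * (1 + (2 * (n : ℝ)) ^ 2)))
          ∂(μ : Measure ((ℝ × ℝ) × (ℝ × ℝ)))| ≤ 8 * C * T n := by
    intro μ n hn hμ hμT
    set K := C * (1 + (2 * (n : ℝ)) ^ 2) with hK
    have hK0 : 0 ≤ K := by positivity
    have hn' : (1 : ℝ) ≤ n := by exact_mod_cast hn
    have hex : Integrable (fun p => excess K (f p)) (μ : Measure ((ℝ × ℝ) × (ℝ × ℝ))) :=
      (hμ.const_mul (8 * C)).mono' ((continuous_excess K).comp hf).aestronglyMeasurable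
        (Filter.Eventually.of_forall fun p => abs_excess_comp_le_tailFn hC hfC hn' p)
    have hcl : Integrable (fun p => max (-K) (min (f p) K))
        (μ : Measure ((ℝ × ℝ) × (ℝ × ℝ))) := by
      refine Integrable.of_bound (C := K) (by fun_prop) (Filter.Eventually.of_forall fun p => ?_)
      exact abs_le.2 ⟨le_max_left _ _, max_le (by linarith) (min_le_right _ _)⟩
    have hsum : ∫ p, f p ∂(μ : Measure ((ℝ × ℝ) × (ℝ × ℝ))) =
        ∫ p, excess K (f p) ∂(μ : Measure ((ℝ × ℝ) × (ℝ × ℝ))) +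
        ∫ p, max (-K) (min (f p) K) ∂(μ : Measure ((ℝ × ℝ) × (ℝ × ℝ))) := by
      rw [← integral_add hex hcl]
      simp [excess]
    rw [hsum, add_sub_cancel_right]
    calc |∫ p, excess K (f p) ∂(μ : Measure ((ℝ × ℝ) × (ℝ × ℝ)))|
        ≤ ∫ p, |excess K (f p)| ∂(μ : Measure ((ℝ × ℝ) × (ℝ × ℝ))) := abs_integral_le_integral_abs
      _ ≤ ∫ p, 8 * C * tailFn n p ∂(μ : Measure ((ℝ × ℝ) × (ℝ × ℝ))) :=
          integral_mono hex.abs (hμ.const_mul _)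
            fun p => abs_excess_comp_le_tailFn hC hfC hn' p
      _ ≤ 8 * C * T n := by
          rw [integral_const_mul]; gcongr
  rw [Metric.tendsto_atTop]
  intro ε hε
  have hsmall : Filter.Tendsto (fun n => 8 * C * T n) Filter.atTop (nhds 0) := by
    simpa using hT0.const_mul (8 * C)
  obtain ⟨n, hn, hn1⟩ := ((hsmall.eventually_lt_const (show (0 : ℝ) < ε / 3 by linarith)).and
    (Filter.eventually_ge_atTop 1)).exists
  set K := C * (1 + (2 * (n : ℝ)) ^ 2) with hK
  have hK0 : 0 ≤ K := by positivity
  let F : BoundedContinuousFunction ((ℝ × ℝ) × (ℝ × ℝ)) ℝ :=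
    BoundedContinuousFunction.ofNormedAddCommGroup (fun p => max (-K) (min (f p) K))
      (by fun_prop) K fun p =>
        abs_le.2 ⟨le_max_left _ _, max_le (by linarith) (min_le_right _ _)⟩
  have hF := ProbabilityMeasure.tendsto_iff_forall_integral_tendsto.1 hlim F
  obtain ⟨N, hN⟩ := (Metric.tendsto_atTop.1 hF) (ε / 3) (by linarith)
  refine ⟨N, fun i hi' => ?_⟩
  have a₁ := trunc (γs i) n hn1 (hi i n) (hT i n)
  obtain ⟨hγi, hγT⟩ := integrable_tailFn_of_tendsto hlim (fun i => hi i n) (fun i => hT i n)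
  have a₂ := trunc γ n hn1 hγi hγT
  have a₃ := hN i hi'
  simp only [F, Real.dist_eq, BoundedContinuousFunction.coe_ofNormedAddCommGroup] at a₃ ⊢
  rw [abs_le] at a₁ a₂
  rw [abs_lt] at a₃ ⊢
  constructor <;> linarith [a₁.1, a₁.2, a₂.1, a₂.2, a₃.1, a₃.2]

/-- The positive and negative parts of a, as densities, push forward under the first projection to
finite measures that agree on bounded continuous functions, hence coincide. -/
lemma setIntegral_preimage_fst_eq_zero {γ : Measure ((ℝ × ℝ) × (ℝ × ℝ))} [IsFiniteMeasure γ]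
    {a : (ℝ × ℝ) × (ℝ × ℝ) → ℝ} (ham : Measurable a) (ha : Integrable a γ)
    (h : ∀ ψ : BoundedContinuousFunction (ℝ × ℝ) ℝ, ∫ p, ψ p.1 * a p ∂γ = 0)
    {s : Set (ℝ × ℝ)} (hs : MeasurableSet s) : ∫ p in Prod.fst ⁻¹' s, a p ∂γ = 0 := by
  let m : ((ℝ × ℝ) × (ℝ × ℝ) → ℝ) → Measure (ℝ × ℝ) := fun b =>
    (γ.withDensity (fun p => ENNReal.ofReal (b p))).map Prod.fst
  have hfin : ∀ b, Integrable b γ → IsFiniteMeasure (m b) := by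
    intro b hb
    have := isFiniteMeasure_withDensity_ofReal hb.2
    infer_instance
  have hint : ∀ b, Measurable b → ∀ ψ : BoundedContinuousFunction (ℝ × ℝ) ℝ,
      ∫ x, ψ x ∂(m b) = ∫ p, ψ p.1 * max (b p) 0 ∂γ := by
    intro b hb ψ
    simp only [m]
    rw [integral_map measurable_fst.aemeasurable ψ.continuous.aestronglyMeasurable,
      integral_withDensity_eq_integral_toReal_smul (by fun_prop) (by simp)]
    refine integral_congr_ae (Filter.Eventually.of_forall fun p => ?_)
    simp only [smul_eq_mul, ENNReal.toReal_ofReal']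
    ring
  have hψint : ∀ (ψ : BoundedContinuousFunction (ℝ × ℝ) ℝ) (b : (ℝ × ℝ) × (ℝ × ℝ) → ℝ),
      Integrable b γ → Integrable (fun p => ψ p.1 * b p) γ := fun ψ b hb =>
    hb.bdd_mul (ψ.continuous.comp continuous_fst).aestronglyMeasurable
      (Filter.Eventually.of_forall fun p => ψ.norm_coe_le_norm p.1)
  have := hfin a ha
  have := hfin (fun p => -a p) ha.neg
  have heq : m a = m (fun p => -a p) := by
    refine ext_of_forall_integral_eq_of_IsFiniteMeasure fun ψ => ?_
    rw [hint a ham, hint (fun p => -a p) ham.neg, ← sub_eq_zero,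
      ← integral_sub (hψint ψ _ ha.pos_part) (hψint ψ _ ha.neg_part)]
    refine (integral_congr_ae (Filter.Eventually.of_forall fun p => ?_)).trans (h ψ)
    rcases le_total (a p) 0 with h' | h'
    · rw [max_eq_right h', max_eq_left (by linarith)]; ring
    · rw [max_eq_left h', max_eq_right (by linarith)]; ring
  have hv := congrArg (fun μ => μ s) heq
  simp only [m, Measure.map_apply measurable_fst hs, withDensity_apply _ (measurable_fst hs)] at hv
  rw [integral_eq_lintegral_pos_part_sub_lintegral_neg_part ha.integrableOn, hv, sub_self]

/-- Martingale plans with fixed second marginal are closed under weak limits, and the cost is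
continuous along them. -/
lemma mem_martingalePlans_of_tendsto {ν : Measure (ℝ × ℝ)} (hν : HasP2 ν)
    {γs : ℕ → ProbabilityMeasure ((ℝ × ℝ) × (ℝ × ℝ))}
    {γ : ProbabilityMeasure ((ℝ × ℝ) × (ℝ × ℝ))} (hlim : Filter.Tendsto γs Filter.atTop (nhds γ))
    (hmem : ∀ i, (γs i : Measure ((ℝ × ℝ) × (ℝ × ℝ))) ∈ martingalePlans ν) :
    (γ : Measure ((ℝ × ℝ) × (ℝ × ℝ))) ∈ martingalePlans ν ∧
    Filter.Tendsto (fun i => ∫ p, covCost p.1 p.2 ∂(γs i : Measure ((ℝ × ℝ) × (ℝ × ℝ))))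
      Filter.atTop (nhds (∫ p, covCost p.1 p.2 ∂(γ : Measure ((ℝ × ℝ) × (ℝ × ℝ))))) := by
  have hi : ∀ i (n : ℕ), Integrable (tailFn n) (γs i : Measure ((ℝ × ℝ) × (ℝ × ℝ))) :=
    fun i n => integrable_tailFn (hmem i).1 n.cast_nonneg
  have hT : ∀ i (n : ℕ), ∫ p, tailFn n p ∂(γs i : Measure ((ℝ × ℝ) × (ℝ × ℝ))) ≤ tailBound ν n :=
    fun i n => integral_tailFn_le (hmem i) n.cast_nonneg
  have conv : ∀ f : (ℝ × ℝ) × (ℝ × ℝ) → ℝ, Continuous f → ∀ C : ℝ, 0 ≤ C →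
      (∀ p, |f p| ≤ C * (1 + ‖p‖ ^ 2)) → Filter.Tendsto
        (fun i => ∫ p, f p ∂(γs i : Measure ((ℝ × ℝ) × (ℝ × ℝ)))) Filter.atTop
        (nhds (∫ p, f p ∂(γ : Measure ((ℝ × ℝ) × (ℝ × ℝ))))) :=
    fun f hf C hC hfC =>
      tendsto_integral_of_tendsto_of_tailFn hlim (tendsto_tailBound hν) hi hT hf hC hfC
  have c₁ : ∀ p : (ℝ × ℝ) × (ℝ × ℝ), |p.1.1| ≤ ‖p‖ :=
    fun p => (norm_fst_le p.1).trans (norm_fst_le p)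
  have c₂ : ∀ p : (ℝ × ℝ) × (ℝ × ℝ), |p.1.2| ≤ ‖p‖ :=
    fun p => (norm_snd_le p.1).trans (norm_fst_le p)
  have c₃ : ∀ p : (ℝ × ℝ) × (ℝ × ℝ), |p.2.1| ≤ ‖p‖ :=
    fun p => (norm_fst_le p.2).trans (norm_snd_le p)
  have c₄ : ∀ p : (ℝ × ℝ) × (ℝ × ℝ), |p.2.2| ≤ ‖p‖ :=
    fun p => (norm_snd_le p.2).trans (norm_snd_le p)
  have hdiff : ∀ (u w : ℝ) {r : ℝ}, |u| ≤ r → |w| ≤ r → |u - w| ≤ 2 * r := by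
    intro u w r hu hw
    have := abs_sub u w
    linarith
  have hP : HasP2 (γ : Measure ((ℝ × ℝ) × (ℝ × ℝ))) := by
    refine ⟨inferInstance, (memLp_two_iff_integrable_sq_norm aestronglyMeasurable_id).2 ?_⟩
    have h0 := (integrable_tailFn_of_tendsto hlim (fun i => hi i 0) (fun i => hT i 0)).1
    rw [Nat.cast_zero] at h0
    refine h0.mono' (by fun_prop) (Filter.Eventually.of_forall fun p => ?_)
    rw [Real.norm_of_nonneg (by positivity)]
    exact norm_sq_le_tailFn_zero p
  have hmarg : (γ : Measure ((ℝ × ℝ) × (ℝ × ℝ))).map Prod.snd = ν := by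
    have := hν.1
    have hm : IsProbabilityMeasure ((γ : Measure ((ℝ × ℝ) × (ℝ × ℝ))).map Prod.snd) :=
      Measure.isProbabilityMeasure_map measurable_snd.aemeasurable
    refine ext_of_forall_integral_eq_of_IsFiniteMeasure fun ψ => ?_
    rw [integral_map measurable_snd.aemeasurable ψ.continuous.aestronglyMeasurable]
    have h := conv (fun p => ψ p.2) (by fun_prop) ‖ψ‖ (norm_nonneg _) fun p =>
      (ψ.norm_coe_le_norm p.2).trans (le_mul_of_one_le_right (norm_nonneg _)
        (by linarith [sq_nonneg ‖p‖]))
    refine tendsto_nhds_unique h (tendsto_const_nhds.congr fun i => ?_)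
    rw [← (hmem i).2.1, integral_map measurable_snd.aemeasurable
      ψ.continuous.aestronglyMeasurable]
  -- Bounded continuous tests pass to the weak limit because ψ(x)(y - x) has at most quadratic
  -- growth.
  have test : ∀ x y : (ℝ × ℝ) × (ℝ × ℝ) → ℝ, Continuous x → Continuous y →
      (∀ p, |x p| ≤ ‖p‖) → (∀ p, |y p| ≤ ‖p‖) →
      (∀ i (ψ : BoundedContinuousFunction (ℝ × ℝ) ℝ),
        ∫ p, ψ p.1 * (y p - x p) ∂(γs i : Measure ((ℝ × ℝ) × (ℝ × ℝ))) = 0) →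
      ∀ s, MeasurableSet s →
        ∫ p in Prod.fst ⁻¹' s, x p ∂(γ : Measure ((ℝ × ℝ) × (ℝ × ℝ))) =
          ∫ p in Prod.fst ⁻¹' s, y p ∂(γ : Measure ((ℝ × ℝ) × (ℝ × ℝ))) := by
    intro x y hx hy nx ny h0 s hs
    have ix : Integrable x (γ : Measure ((ℝ × ℝ) × (ℝ × ℝ))) :=
      (hP.memLp_of_norm_le hx.aestronglyMeasurable nx).integrable one_le_two
    have iy : Integrable y (γ : Measure ((ℝ × ℝ) × (ℝ × ℝ))) :=
      (hP.memLp_of_norm_le hy.aestronglyMeasurable ny).integrable one_le_two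
    have h := setIntegral_preimage_fst_eq_zero (a := fun p => y p - x p)
      (hy.sub hx).measurable (iy.sub ix) (fun ψ => ?_) hs
    · rw [integral_sub iy.integrableOn ix.integrableOn] at h
      linarith
    · have h := conv (fun p => ψ p.1 * (y p - x p)) (by fun_prop) (2 * ‖ψ‖) (by positivity)
        fun p => by
          rw [abs_mul]
          have h₁ := ψ.norm_coe_le_norm p.1
          rw [Real.norm_eq_abs] at h₁
          have h₂ := hdiff _ _ (ny p) (nx p)
          calc |ψ p.1| * |y p - x p| ≤ ‖ψ‖ * (2 * ‖p‖) := by gcongr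
            _ ≤ 2 * ‖ψ‖ * (1 + ‖p‖ ^ 2) := by
              have : ‖p‖ ≤ 1 + ‖p‖ ^ 2 := by nlinarith [sq_nonneg (‖p‖ - 1), sq_nonneg ‖p‖]
              nlinarith [norm_nonneg ψ, mul_le_mul_of_nonneg_left this (norm_nonneg ψ)]
      exact tendsto_nhds_unique h (tendsto_const_nhds.congr fun i => (h0 i ψ).symm)
  have hψ2 : ∀ i (ψ : BoundedContinuousFunction (ℝ × ℝ) ℝ),
      MemLp (fun p : (ℝ × ℝ) × (ℝ × ℝ) => ψ p.1) 2
        (γs i : Measure ((ℝ × ℝ) × (ℝ × ℝ))) := fun i ψ =>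
    MemLp.of_bound (ψ.continuous.comp continuous_fst).aestronglyMeasurable ‖ψ‖
      (Filter.Eventually.of_forall fun p => ψ.norm_coe_le_norm p.1)
  refine ⟨mem_martingalePlans_of_setIntegral hP hmarg ?_ ?_, ?_⟩
  · exact test _ _ (by fun_prop) (by fun_prop) c₁ c₃ fun i ψ =>
      (integral_mul_sub_eq_zero_of_mem (hmem i) ψ.continuous.measurable (hψ2 i ψ)).1
  · exact test _ _ (by fun_prop) (by fun_prop) c₂ c₄ fun i ψ =>
      (integral_mul_sub_eq_zero_of_mem (hmem i) ψ.continuous.measurable (hψ2 i ψ)).2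
  · refine conv _ (by unfold covCost; fun_prop) 4 (by norm_num) fun p => ?_
    unfold covCost
    rw [abs_mul]
    calc |p.1.1 - p.2.1| * |p.1.2 - p.2.2| ≤ (2 * ‖p‖) * (2 * ‖p‖) :=
          mul_le_mul (hdiff _ _ (c₁ p) (c₃ p)) (hdiff _ _ (c₂ p) (c₄ p)) (abs_nonneg _)
            (by positivity)
      _ ≤ 4 * (1 + ‖p‖ ^ 2) := by nlinarith

/-! ### Compactness and existence. -/

lemma diagonal_mem_martingalePlans {ν : Measure (ℝ × ℝ)} (hν : HasP2 ν) :
    ν.map (fun y => (y, y)) ∈ martingalePlans ν := by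
  have := hν.1
  have hT : Measurable (fun y : ℝ × ℝ => (y, y)) := by fun_prop
  refine mem_martingalePlans_of_setIntegral
    ⟨Measure.isProbabilityMeasure_map hT.aemeasurable, ?_⟩ ?_ ?_ ?_
  · refine (memLp_map_measure_iff aestronglyMeasurable_id hT.aemeasurable).2 ?_
    refine hν.2.mono hT.aestronglyMeasurable (Filter.Eventually.of_forall fun y => ?_)
    simp [Prod.norm_def]
  · rw [Measure.map_map measurable_snd hT]
    exact Measure.map_id
  · intro s hs
    rw [setIntegral_map (measurable_fst hs) (by fun_prop) hT.aemeasurable,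
      setIntegral_map (measurable_fst hs) (by fun_prop) hT.aemeasurable]
  · intro s hs
    rw [setIntegral_map (measurable_fst hs) (by fun_prop) hT.aemeasurable,
      setIntegral_map (measurable_fst hs) (by fun_prop) hT.aemeasurable]

/-- Markov's inequality for `tailFn 0`, which dominates the squared norm and has a uniformly bounded
integral. -/
lemma isTightMeasureSet_martingalePlans (ν : Measure (ℝ × ℝ)) :
    IsTightMeasureSet (martingalePlans ν) := by
  refine isTightMeasureSet_of_tendsto_measure_norm_gt ?_
  have lim : Filter.Tendsto (fun r : ℝ => ENNReal.ofReal (tailBound ν 0 / r ^ 2)) Filter.atTop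
      (nhds 0) := by
    have h := (tendsto_const_nhds (x := tailBound ν 0)).div_atTop
      (Filter.tendsto_pow_atTop (α := ℝ) two_ne_zero)
    simpa using ENNReal.tendsto_ofReal h
  refine tendsto_of_tendsto_of_tendsto_of_le_of_le' tendsto_const_nhds lim
    (Filter.Eventually.of_forall fun _ => zero_le) ?_
  filter_upwards [Filter.eventually_gt_atTop 0] with r hr
  refine iSup₂_le fun γ hγ => ?_
  have := hγ.1.1
  have hi := integrable_tailFn hγ.1 le_rfl
  have h1 := mul_meas_ge_le_integral_of_nonneg
    (Filter.Eventually.of_forall fun p => tailFn_nonneg 0 p) hi (r ^ 2)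
  have h2 := integral_tailFn_le hγ le_rfl
  refine (ENNReal.le_ofReal_iff_toReal_le (measure_ne_top _ _) ?_).2 ?_
  · exact div_nonneg ((integral_nonneg fun p => tailFn_nonneg 0 p).trans h2) (by positivity)
  · rw [le_div_iff₀ (by positivity), mul_comm]
    refine le_trans ?_ (h1.trans h2)
    gcongr
    refine measureReal_mono fun p hp => ?_
    have hp' : r < ‖p‖ := hp
    change r ^ 2 ≤ tailFn 0 p
    exact le_trans (by gcongr) (norm_sq_le_tailFn_zero p)

lemma exists_isOptimalPlan {ν : Measure (ℝ × ℝ)} (hν : HasP2 ν) : ∃ γ, IsOptimalPlan ν γ := by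
  let K : Set (ProbabilityMeasure ((ℝ × ℝ) × (ℝ × ℝ))) :=
    {γ | (γ : Measure ((ℝ × ℝ) × (ℝ × ℝ))) ∈ martingalePlans ν}
  have hclosed : IsClosed K := by
    refine IsSeqClosed.isClosed fun γs γ hmem hlim => ?_
    exact (mem_martingalePlans_of_tendsto hν hlim hmem).1
  have hcompact : IsCompact K := by
    rw [← hclosed.closure_eq]
    -- Prokhorov's theorem.
    refine isCompact_closure_of_isTightMeasureSet
      ((isTightMeasureSet_martingalePlans ν).subset ?_)
    rintro _ ⟨γ, hγ, rfl⟩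
    exact hγ
  have hcont : ContinuousOn
      (fun γ : ProbabilityMeasure ((ℝ × ℝ) × (ℝ × ℝ)) =>
        ∫ p, covCost p.1 p.2 ∂(γ : Measure ((ℝ × ℝ) × (ℝ × ℝ)))) K := by
    rw [continuousOn_iff_continuous_domRestrict, continuous_iff_seqContinuous]
    intro γs γ hlim
    exact (mem_martingalePlans_of_tendsto hν (tendsto_subtype_rng.1 hlim)
      fun i => (γs i).2).2
  have hdiag := diagonal_mem_martingalePlans hν
  obtain ⟨γ, hγ, hmin⟩ := hcompact.exists_isMinOn
    ⟨(⟨ν.map (fun y => (y, y)), hdiag.1.1⟩ : ProbabilityMeasure _), hdiag⟩ hcont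
  refine ⟨γ, hγ, fun ζ hζ => ?_⟩
  exact hmin (show (⟨ζ, hζ.1.1⟩ : ProbabilityMeasure _) ∈ K from hζ)

theorem theorem1 (ν : Measure (ℝ × ℝ)) (hν : HasP2 ν) :
    (∃ γ, IsOptimalPlan ν γ) ∧
    ∀ γ ∈ martingalePlans ν,
      List.TFAE [
        IsOptimalPlan ν γ,
        ∀ x₀ y₀ x₁ y₁ : ℝ × ℝ, (x₀, y₀) ∈ γ.support → (x₁, y₁) ∈ γ.support →
          ∀ t ∈ Set.Icc (0 : ℝ) 1,
            (1 - t) * covCost x₀ y₀ + t * covCost x₁ y₁ ≤ t * (1 - t) * covCost y₀ y₁,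
        ∃ G, IsMaximalMonotoneSet G ∧
          ∀ x y : ℝ × ℝ, (x, y) ∈ γ.support → (covCost x y : EReal) ≤ phiG G y] ∧
      ∀ G, IsMaximalMonotoneSet G →
        (∀ x y : ℝ × ℝ, (x, y) ∈ γ.support → (covCost x y : EReal) ≤ phiG G y) →
        (γ.map Prod.fst).support ⊆ G ∧
        ∀ x y : ℝ × ℝ, (x, y) ∈ γ.support →
          (covCost x y : EReal) = phiG G y ∧
          IsLeast ((fun z => covCost z y) '' G) (covCost x y) := by
  refine ⟨exists_isOptimalPlan hν, fun γ hγ => ⟨?_, fun G hG hle => ?_⟩⟩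
  · have := hγ.1.1
    tfae_have 1 → 2 := fun h => h.pairwiseOptimal_support
    tfae_have 2 → 3 := fun h => by
      obtain ⟨G, hG, hle⟩ := PairwiseOptimal.exists_isMaximalMonotoneSet (S := γ.support) h
        (Measure.nonempty_support (IsProbabilityMeasure.ne_zero γ))
      exact ⟨G, hG, fun x y hxy => coe_covCost_le_phiG_iff.2 (hle x y hxy)⟩
    tfae_have 3 → 1 := by
      rintro ⟨G, hG, hle⟩
      obtain ⟨f, hf, rfl⟩ := hG.exists_eq_rotatedGraph
      refine isOptimalPlan_of_le hγ hf ?_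
      filter_upwards [ae_mem_support γ] with p hp
      exact coe_covCost_le_phiG_iff.1 (hle p.1 p.2 hp)
    tfae_finish
  · obtain ⟨f, hf, rfl⟩ := hG.exists_eq_rotatedGraph
    have hae : ∀ᵐ p ∂γ, ∀ z ∈ rotatedGraph f, covCost p.1 p.2 ≤ covCost z p.2 := by
      filter_upwards [ae_mem_support γ] with p hp
      exact coe_covCost_le_phiG_iff.1 (hle p.1 p.2 hp)
    have hsub := map_fst_support_subset (isClosed_rotatedGraph hf.continuous)
      (ae_fst_mem_rotatedGraph hγ hf hae)
    refine ⟨hsub, fun x y hxy => ?_⟩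
    -- Once x belongs to G it competes in the infimum, so (1) becomes an equality and the minimum is
    -- attained at x.
    have hx : x ∈ rotatedGraph f := hsub (fst_mem_support_map hxy)
    refine ⟨le_antisymm (hle x y hxy) (iInf₂_le x hx), ⟨x, hx, rfl⟩, ?_⟩
    rintro _ ⟨z, hz, rfl⟩
    exact coe_covCost_le_phiG_iff.1 (hle x y hxy) z hz
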